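/- **Setting.** Let $n\ge 1$ workers hold datasets $\mathcal D_i=(x_{i,1},\dots,x_{i,m})$, and let $\mathcal H\subseteq[n]$, $|\mathcal H|=n-f$, be the set of honest workers, where $n\ge(2+\eta)f$ for a constant $\eta>0$. For $\theta\in\mathbb R^d$ let $\mathcal L_i(\theta)=\frac1m\sum_j\ell(\theta;x_{i,j})$, $\mathcal L_{\mathcal H}=\frac1{n-f}\sum_{i\in\mathcal H}\mathcal L_i$ and $\mathcal L_\star=\inf_\theta\mathcal L_{\mathcal H}(\theta)$, where $\ell(\cdot;x)$ is differentiable for every data point $x$ of an honest worker. Assume that * (bounded heterogeneity) $\frac1{n-f}\sum_{i\in\mathcal H}\langle v,\nabla\mathcal L_i(\theta)-\nabla\mathcal L_{\mathcal H}(\theta)\rangle^2\le G_{\mathrm{cov}}^2$ for all $\theta$ and all $\|v\|\le1$, where $G_{\mathrm{cov}}>0$; * (bounded variance) $\frac1m\sum_j\|\nabla\ell(\theta;x_{i,j})-\nabla\mathcal L_i(\theta)\|^2\le\sigma^2$ for all $\theta$ and all $i\in\mathcal H$, where $\sigma>0$; * for some $L,\mu>0$, $\mathcal L_{\mathcal H}$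 is $L$-smooth and $\mu$-strongly convex: $\frac\mu2\|\theta'-\theta\|^2\le\mathcal L_{\mathcal H}(\theta')-\mathcal L_{\mathcal H}(\theta)-\langle\nabla\mathcal L_{\mathcal H}(\theta),\theta'-\theta\rangle\le\frac L2\|\theta'-\theta\|^2$ for all $\theta,\theta'$. **Algorithm** (CafCor with the coordinate-wise trimmed mean, $T$ steps). Let $C,\varepsilon>0$, $\delta\in(0,1)$, $1\le b\le m$, $\theta_0\in\mathbb R^d$, and $$s_T=\frac{32\,C^2\,T\log(1/\delta)}{\varepsilon^2(n-f)},\qquad \gamma_t=\frac{10}{\mu\,(t+240L/\mu)},\qquad \beta_t=1-24L\gamma_t .$$ Start from $m_0^{(i)}=0$. For $t=0,\dots,T-1$, the server receives $m_t^{(i)}$ from every $i\in\mathcal H$ and an arbitrary vector from every $i\notin\mathcal H$, computes the coordinate-wise trimmed mean $R_t$ of the $n$ vectors (in each coordinate, discard the $f$ smallest and the $f$ largest values and average the other $n-2f$), and sets $\theta_{t+1}=\theta_t-\gamma_tR_t$. Then every $i\in\mathcal H$ sets $m_{t+1}^{(i)}=\beta_tm_t^{(i)}+(1-\beta_t)\tilde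 g_{t+1}^{(i)}$ with $$\tilde g_{t}^{(i)}=\frac1b\sum_{j\in S_t^{(i)}}\nabla\ell(\theta_t;x_{i,j})+\sum_{j\ne i}v_t^{(ij)}+\bar v_t^{(i)},\qquad v_t^{(ij)}=-v_t^{(ji)}\sim\mathcal N(0,s_TI_d),\quad \bar v_t^{(i)}\sim\mathcal N(0,s_TI_d),$$ where $S_t^{(i)}$ is a uniformly random $b$-subset of $[m]$ and all these draws are independent, except for $v^{(ij)}_t=-v^{(ji)}_t$. The messages of the malicious workers at step $t$ may be any measurable function of their private randomness (independent of the above) and of everything drawn up to and including step $t$. The output is $\theta_T$. The algorithm is $(f,\varrho)$-robust if, for every such behaviour of the malicious workers, $\mathcal L_{\mathcal H}(\theta_T)-\mathcal L_\star$ is integrable and $\mathbb E[\mathcal L_{\mathcal H}(\theta_T)-\mathcal L_\star]\le\varrho$. **Theorem.** For every $\eta>0$ there is a constant $K>0$, depending only on $\eta$, such that, in every setting as above, for all sufficiently large $T$ the algorithm is $(f,\varrho)$-robust with $$\varrho=K\left(\frac{L}{\mu^2}\left[\frac fn\cdot\frac{C^2d\log(1/\delta)}{\varepsilon^2}+\frac{C^2d\log(1/\delta)}{n^2\varepsilon^2}\right]+\frac1\mu\cdot\frac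 fn\,d\,G_{\mathrm{cov}}^2\right).$$ How large $T$ must be does not depend on the behaviour of the malicious workers. (If every $\|\nabla\ell(\theta;x)\|\le C$, clipping gradients at level $C$ would not change the algorithm.) -/

import Mathlib

open MeasureTheory ProbabilityTheory

noncomputable section

namespace CafCor

/-- Parameter space `ℝ^d` with the Euclidean norm. -/
abbrev E (d : ℕ) : Type := EuclideanSpace ℝ (Fin d)

/-! ### Losses and assumptions -/

section Losses

variable {X : Type*} {n m d : ℕ}

/-- Gradient of the pointwise loss `ℓ(·; x)` at `θ`. -/
def pointGrad (ℓ : E d → X → ℝ) (x : X) (θ : E d) : E d :=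
  gradient (fun θ' => ℓ θ' x) θ

/-- Empirical loss `L_i` of worker `i`, whose dataset is `D i 0, …, D i (m - 1)`. -/
def localLoss (ℓ : E d → X → ℝ) (D : Fin n → Fin m → X) (i : Fin n) (θ : E d) : ℝ :=
  (m : ℝ)⁻¹ * ∑ j, ℓ θ (D i j)

/-- Global honest loss `L_H`. -/
def honestLoss (ℓ : E d → X → ℝ) (D : Fin n → Fin m → X) (H : Finset (Fin n)) (θ : E d) : ℝ :=
  (H.card : ℝ)⁻¹ * ∑ i ∈ H, localLoss ℓ D i θ

/-- `L`-smoothness. -/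
def IsSmooth (L : ℝ) (F : E d → ℝ) : Prop :=
  ∀ θ θ' : E d, F θ' - F θ - inner ℝ (gradient F θ) (θ' - θ) ≤ L / 2 * ‖θ' - θ‖ ^ 2

/-- `μ`-strong convexity. -/
def IsStronglyConvex (μ : ℝ) (F : E d → ℝ) : Prop :=
  ∀ θ θ' : E d, μ / 2 * ‖θ' - θ‖ ^ 2 ≤ F θ' - F θ - inner ℝ (gradient F θ) (θ' - θ)

/-- Bounded heterogeneity: in every direction, the variance of the honest workers' gradients is at
most `G ^ 2`. -/
def BoundedHeterogeneity (ℓ : E d → X → ℝ) (D : Fin n → Fin m → X) (H : Finset (Fin n))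
    (G : ℝ) : Prop :=
  ∀ θ v : E d, ‖v‖ ≤ 1 →
    (H.card : ℝ)⁻¹ * ∑ i ∈ H,
      (inner ℝ v (gradient (localLoss ℓ D i) θ - gradient (honestLoss ℓ D H) θ)) ^ 2 ≤ G ^ 2

/-- Bounded variance of the pointwise gradients of every honest worker. -/
def BoundedVariance (ℓ : E d → X → ℝ) (D : Fin n → Fin m → X) (H : Finset (Fin n))
    (σ : ℝ) : Prop :=
  ∀ i ∈ H, ∀ θ : E d,
    (m : ℝ)⁻¹ * ∑ j, ‖pointGrad ℓ (D i j) θ - gradient (localLoss ℓ D i) θ‖ ^ 2 ≤ σ ^ 2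

end Losses

/-! ### Coordinate-wise trimmed mean -/

/-- Trimmed mean of `n` reals: sort them, discard the `f` smallest and the `f` largest ones, and
average the remaining `n - 2 f`. -/
def trimmedMean {n : ℕ} (f : ℕ) (x : Fin n → ℝ) : ℝ :=
  ((n : ℝ) - 2 * f)⁻¹ *
    ∑ r ∈ Finset.univ.filter (fun r : Fin n => f ≤ (r : ℕ) ∧ (r : ℕ) + f < n),
      x (Tuple.sort x r)

/-- Coordinate-wise trimmed mean. -/
def cwtm {n d : ℕ} (f : ℕ) (x : Fin n → E d) : E d :=
  WithLp.toLp 2 fun k => trimmedMean f fun i => x i k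

/-! ### Randomness of the honest workers -/

/-- The randomness drawn in one step: the mini-batches `S i`, the pairwise shared Gaussian vectors
`w i j` (only the entries with `i < j` are used), and the independent Gaussian vectors `u i`. -/
abbrev Round (n m d : ℕ) : Type :=
  (Fin n → Finset (Fin m)) × (Fin n → Fin n → E d) × (Fin n → E d)

/-- A uniformly random subset of `b` of the `m` data points (sampling without replacement). -/
def batchLaw (m b : ℕ) : Measure (Finset (Fin m)) :=
  uniformOn ((Finset.univ : Finset (Fin m)).powersetCard b : Set (Finset (Fin m)))

/-- The Gaussian law `N(0, s I_d)`, where `s ≥ 0` is the variance of a coordinate. -/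
def gaussianLaw (d : ℕ) (s : ℝ) : Measure (E d) :=
  (stdGaussian (E d)).map fun z => √s • z

/-- Law of the randomness of one step; all its components are independent. -/
def roundLaw (n m d b : ℕ) (sCor sInd : ℝ) : Measure (Round n m d) :=
  (Measure.pi fun _ : Fin n => batchLaw m b).prod
    ((Measure.pi fun _ : Fin n => Measure.pi fun _ : Fin n => gaussianLaw d sCor).prod
      (Measure.pi fun _ : Fin n => gaussianLaw d sInd))

/-- The correlated noise `v i j = - v j i` between workers `i` and `j`. -/
def corNoise {n m d : ℕ} (ρ : Round n m d) (i j : Fin n) : E d :=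
  if i < j then ρ.2.1 i j else -ρ.2.1 j i

/-- The total noise `∑_{j ≠ i} v i j + u i` that worker `i` adds to its gradient. -/
def noise {n m d : ℕ} (ρ : Round n m d) (i : Fin n) : E d :=
  ∑ j ∈ Finset.univ.erase i, corNoise ρ i j + ρ.2.2 i

/-! ### The algorithm -/

/-- A strategy of the malicious workers, with private randomness in `A`. Their messages at step `t`
are an arbitrary measurable function of the private randomness and of everything that the workers
have drawn up to and including step `t` (hence of all models and all honest messages so far). -/
structure Adversary (n m d : ℕ) (A : Type) [MeasurableSpace A] where
  /-- `msg t s i` is the message of worker `i` at step `t`, used only if `i` is malicious. -/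
  msg : ∀ t : ℕ, A × (Finset.Iic t → Round n m d) → Fin n → E d
  measurable_msg : ∀ t, Measurable (msg t)

/-- Parameters of the algorithm. -/
structure Params (n d : ℕ) where
  /-- aggregation rule used by the server -/
  agg : (Fin n → E d) → E d
  /-- mini-batch size -/
  batchSize : ℕ
  /-- variance of the correlated noise -/
  varCor : ℝ
  /-- variance of the independent noise -/
  varInd : ℝ
  /-- learning rates -/
  lr : ℕ → ℝ
  /-- momentum coefficients -/
  mom : ℕ → ℝ
  /-- initial model -/
  init : E d

section Algorithm

variable {X : Type*} {n m d : ℕ}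

/-- Mini-batch gradient of worker `i` on the batch `S`. -/
def batchGrad (ℓ : E d → X → ℝ) (D : Fin n → Fin m → X) (i : Fin n) (S : Finset (Fin m))
    (θ : E d) : E d :=
  (S.card : ℝ)⁻¹ • ∑ j ∈ S, pointGrad ℓ (D i j) θ

/-- Noisy gradient of the honest worker `i`. -/
def noisyGrad (ℓ : E d → X → ℝ) (D : Fin n → Fin m → X) (ρ : Round n m d) (i : Fin n)
    (θ : E d) : E d :=
  batchGrad ℓ D i (ρ.1 i) θ + noise ρ i

/-- The pair `(θ_t, (m_t^(i))_i)` of the current model and the honest momentums.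
At `t = 0` all momentums are `0`. Then `θ_{t+1} = θ_t - γ_t R_t`, where `R_t` aggregates the
momentums `m_t^(i)` of the honest workers and the messages of the malicious ones, and
`m_{t+1}^(i) = β_t m_t^(i) + (1 - β_t) g_{t+1}^(i)`, where `g_{t+1}^(i)` is the noisy mini-batch
gradient at `θ_{t+1}`. -/
def state (ℓ : E d → X → ℝ) (D : Fin n → Fin m → X) (H : Finset (Fin n)) (p : Params n d)
    {A : Type} [MeasurableSpace A] (adv : Adversary n m d A) (a : A) (ω : ℕ → Round n m d) :
    ℕ → E d × (Fin n → E d)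
  | 0 => (p.init, 0)
  | t + 1 =>
    let s := state ℓ D H p adv a ω t
    let R : E d := p.agg fun i =>
      if i ∈ H then s.2 i else adv.msg t (a, fun k => ω k) i
    let θ : E d := s.1 - p.lr t • R
    (θ, fun i => p.mom t • s.2 i + (1 - p.mom t) • noisyGrad ℓ D (ω (t + 1)) i θ)

/-- Law of all the randomness: the private randomness of the malicious workers and the independent
steps of the honest workers. -/
def runLaw (m : ℕ) (p : Params n d) {A : Type} [MeasurableSpace A] (ν : Measure A) :
    Measure (A × (ℕ → Round n m d)) :=
  ν.prod (Measure.infinitePi fun _ : ℕ => roundLaw n m d p.batchSize p.varCor p.varInd)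

/-- Robustness against the malicious workers outside `H`: whatever they do, the expected
suboptimality of the output `θ_T` for the honest loss exists and is at most `ϱ`. -/
def IsRobust (ℓ : E d → X → ℝ) (D : Fin n → Fin m → X) (H : Finset (Fin n)) (p : Params n d)
    (T : ℕ) (ϱ : ℝ) : Prop :=
  ∀ (A : Type) [MeasurableSpace A] (ν : Measure A) [IsProbabilityMeasure ν]
    (adv : Adversary n m d A),
    Integrable (fun s : A × (ℕ → Round n m d) =>
      honestLoss ℓ D H (state ℓ D H p adv s.1 s.2 T).1 - ⨅ θ, honestLoss ℓ D H θ)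
      (runLaw m p ν) ∧
    ∫ s : A × (ℕ → Round n m d),
      (honestLoss ℓ D H (state ℓ D H p adv s.1 s.2 T).1 - ⨅ θ, honestLoss ℓ D H θ)
      ∂(runLaw m p ν) ≤ ϱ

end Algorithm

/-- The noise variance `32 C² T log(1/δ) / (ε² (n - f))`. -/
def noiseVar (n f T : ℕ) (C ε δ : ℝ) : ℝ :=
  32 * C ^ 2 * T * Real.log (1 / δ) / (ε ^ 2 * ((n : ℝ) - f))

/-- The learning rate `γ_t = 10 / (μ (t + 240 L / μ))`. -/
def stepSize (L μ : ℝ) (t : ℕ) : ℝ := 10 / (μ * (t + 240 * (L / μ)))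

/-- CafCor run for `T` steps, with the coordinate-wise trimmed mean as aggregation rule. -/
def cwtmParams (n d f b T : ℕ) (C ε δ L μ : ℝ) (θ₀ : E d) : Params n d where
  agg := cwtm f
  batchSize := b
  varCor := noiseVar n f T C ε δ
  varInd := noiseVar n f T C ε δ
  lr := stepSize L μ
  mom t := 1 - 24 * L * stepSize L μ t
  init := θ₀

end CafCor

end


/-!
The proof follows the Lyapunov function that adds to the suboptimality `F θ - inf F` of the honest
loss `F` the term `‖M - ∇F θ‖² / L`, where `M` is the mean of the honest momentums. The trimmed mean
stays within `κ` times the spread of the honest momentums of `M`, so a step of the algorithm is an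
inexact gradient step: the Lyapunov function contracts by the factor `1 - μ γ_t` up to an error
`γ_t κ` times the spread and the variance of the mean stochastic gradient.

Whatever the malicious workers send at step `t` is determined before the honest workers draw the
noise of step `t + 1`, so conditioning on the past gives recursions for the expected spread and the
expected Lyapunov function. The momentum averages the noise: the spread tends to the heterogeneity
`d G²` at rate `1 / t`, and for the step sizes `10 / (μ (t + 240 L / μ))` the Lyapunov function
tends to `κ d G² / μ` at the same rate, with a constant proportional to the variances.

The variance of the privacy noise is proportional to `T`, which exactly cancels the factor `1 / T`.
In the sum over the honest workers the noises shared by two honest workers cancel, so each of them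
contributes only the noises it shares with the `f` malicious workers and its own one; this yields
the factor `(f + 1) / (n - f)` in place of `n`.
-/

open MeasureTheory ProbabilityTheory

noncomputable section

namespace CafCor

/-! ### Smooth strongly convex functions -/

section Optimization

variable {d : ℕ} {F : E d → ℝ} {L μ γ : ℝ}

theorem norm_add_sq_le_two_mul {V : Type*} [SeminormedAddCommGroup V] (x y : V) :
    ‖x + y‖ ^ 2 ≤ 2 * ‖x‖ ^ 2 + 2 * ‖y‖ ^ 2 :=
  calc ‖x + y‖ ^ 2 ≤ (‖x‖ + ‖y‖) ^ 2 := by gcongr; exact norm_add_le x y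
    _ ≤ 2 * (‖x‖ ^ 2 + ‖y‖ ^ 2) := add_sq_le
    _ = 2 * ‖x‖ ^ 2 + 2 * ‖y‖ ^ 2 := by ring

theorem IsSmooth.norm_gradient_sub_le (hs : IsSmooth L F) (hc : IsStronglyConvex μ F)
    (hL : 0 < L) (hμ : 0 ≤ μ) (x y : E d) :
    ‖gradient F y - gradient F x‖ ≤ L * ‖y - x‖ := by
  -- Both bounds are compared at the point reached from `y` by a gradient step on the difference.
  set g := gradient F y - gradient F x with hg
  have upper : F (y - L⁻¹ • g) - F y + L⁻¹ * inner ℝ (gradient F y) g ≤ L⁻¹ * ‖g‖ ^ 2 / 2 := by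
    convert hs y (y - L⁻¹ • g) using 1
    · rw [sub_sub_cancel_left, inner_neg_right, real_inner_smul_right, sub_neg_eq_add]
    · rw [sub_sub_cancel_left, norm_neg, norm_smul, mul_pow,
        Real.norm_of_nonneg (inv_nonneg.2 hL.le)]
      field_simp
  have lower : 0 ≤ F (y - L⁻¹ • g) - F x - inner ℝ (gradient F x) (y - x)
      + L⁻¹ * inner ℝ (gradient F x) g := by
    refine (by positivity : 0 ≤ μ / 2 * ‖y - L⁻¹ • g - x‖ ^ 2).trans
      ((hc x (y - L⁻¹ • g)).trans_eq ?_)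
    rw [sub_right_comm y, inner_sub_right, real_inner_smul_right]
    ring
  have inner_sub : L⁻¹ * inner ℝ (gradient F y) g - L⁻¹ * inner ℝ (gradient F x) g
      = L⁻¹ * ‖g‖ ^ 2 := by
    rw [← mul_sub, ← inner_sub_left, ← hg, real_inner_self_eq_norm_sq]
  have cocoercive : L⁻¹ * ‖g‖ ^ 2 ≤ L * ‖y - x‖ ^ 2 := by linarith [hs x y]
  refine le_of_sq_le_sq ?_ (by positivity)
  calc ‖g‖ ^ 2 ≤ L * (L * ‖y - x‖ ^ 2) := (inv_mul_le_iff₀ hL).1 cocoercive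
    _ = (L * ‖y - x‖) ^ 2 := by ring

theorem IsStronglyConvex.sub_le_norm_gradient_sq (hc : IsStronglyConvex μ F) (hμ : 0 < μ)
    (x y : E d) : F x - F y ≤ ‖gradient F x‖ ^ 2 / (2 * μ) := by
  have hinner := neg_le_of_abs_le (abs_real_inner_le_norm (gradient F x) (y - x))
  rw [le_div_iff₀ (by positivity)]
  nlinarith [hc x y, sq_nonneg (‖gradient F x‖ - μ * ‖y - x‖)]

theorem IsStronglyConvex.bddBelow_range (hc : IsStronglyConvex μ F) (hμ : 0 < μ) :
    BddBelow (Set.range F) := by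
  refine ⟨F 0 - ‖gradient F 0‖ ^ 2 / (2 * μ), ?_⟩
  rintro _ ⟨y, rfl⟩
  linarith [hc.sub_le_norm_gradient_sq hμ 0 y]

theorem IsStronglyConvex.sub_iInf_nonneg (hc : IsStronglyConvex μ F) (hμ : 0 < μ) (x : E d) :
    0 ≤ F x - ⨅ y, F y :=
  sub_nonneg.2 (ciInf_le (hc.bddBelow_range hμ) x)

theorem IsStronglyConvex.sub_iInf_le_norm_gradient_sq (hc : IsStronglyConvex μ F) (hμ : 0 < μ)
    (x : E d) : 2 * μ * (F x - ⨅ y, F y) ≤ ‖gradient F x‖ ^ 2 := by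
  rw [← le_div_iff₀' (by positivity), sub_le_comm]
  exact le_ciInf fun y => sub_le_comm.1 (hc.sub_le_norm_gradient_sq hμ x y)

theorem IsStronglyConvex.le_of_isSmooth [Nontrivial (E d)] (hc : IsStronglyConvex μ F)
    (hs : IsSmooth L F) : μ ≤ L := by
  obtain ⟨v, hv⟩ := exists_ne (0 : E d)
  have h := (hc 0 v).trans (hs 0 v)
  rw [sub_zero] at h
  linarith [le_of_mul_le_mul_right h (by positivity)]

theorem IsSmooth.le_of_inexact_step (hs : IsSmooth L F) (γ : ℝ) (θ R : E d) :
    F (θ - γ • R) ≤ F θ - γ / 2 * ‖gradient F θ‖ ^ 2 - γ / 2 * (1 - L * γ) * ‖R‖ ^ 2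
      + γ / 2 * ‖R - gradient F θ‖ ^ 2 := by
  have h := hs θ (θ - γ • R)
  rw [sub_sub_cancel_left, norm_neg, norm_smul, inner_neg_right, real_inner_smul_right, mul_pow,
    Real.norm_eq_abs, sq_abs] at h
  rw [norm_sub_sq_real, real_inner_comm]
  linarith

/-- Lyapunov function of the descent: the suboptimality of the model `θ` plus the squared error of
`M`, the estimate of the gradient at `θ`, in units of `L`. -/
def lyapunov (L : ℝ) (F : E d → ℝ) (θ M : E d) : ℝ :=
  F θ - (⨅ y, F y) + L⁻¹ * ‖M - gradient F θ‖ ^ 2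

theorem sub_iInf_le_lyapunov (hL : 0 ≤ L) (θ M : E d) : F θ - ⨅ y, F y ≤ lyapunov L F θ M :=
  le_add_of_nonneg_right (by positivity)

theorem IsStronglyConvex.lyapunov_nonneg (hc : IsStronglyConvex μ F) (hμ : 0 < μ) (hL : 0 ≤ L)
    (θ M : E d) : 0 ≤ lyapunov L F θ M :=
  (hc.sub_iInf_nonneg hμ θ).trans (sub_iInf_le_lyapunov hL θ M)

theorem sq_mul_add_sq_le {β : ℝ} (hβ : 0 ≤ β) (hβ' : β < 1) (x y : ℝ) :
    β ^ 2 * (x + y) ^ 2 ≤ β * x ^ 2 + y ^ 2 / (1 - β) := by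
  have hpos : 0 < 1 - β := sub_pos.2 hβ'
  have young : β * (1 - β) * (x + y) ^ 2 ≤ (1 - β) * x ^ 2 + β * y ^ 2 := by
    nlinarith [sq_nonneg ((1 - β) * x - β * y)]
  have hβy : β * (β * y ^ 2) ≤ y ^ 2 := by
    rw [← mul_assoc]
    exact mul_le_of_le_one_left (sq_nonneg y) (mul_le_one₀ hβ'.le hβ hβ'.le)
  rw [← sub_le_iff_le_add', le_div_iff₀ hpos]
  linarith [mul_le_mul_of_nonneg_left young hβ]

theorem IsSmooth.norm_sub_gradient_step_sq_le (hs : IsSmooth L F) (hc : IsStronglyConvex μ F)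
    (hL : 0 < L) (hμ : 0 ≤ μ) (hγ : 0 < γ) (hγL : 24 * L * γ ≤ 1) (θ M R : E d) :
    (1 - 24 * L * γ) ^ 2 * ‖M - gradient F (θ - γ • R)‖ ^ 2
      ≤ (1 - 24 * L * γ) * ‖M - gradient F θ‖ ^ 2 + L * γ / 24 * ‖R‖ ^ 2 := by
  have drift : ‖gradient F (θ - γ • R) - gradient F θ‖ ≤ L * γ * ‖R‖ := by
    have h := hs.norm_gradient_sub_le hc hL hμ θ (θ - γ • R)
    rwa [sub_sub_cancel_left, norm_neg, norm_smul, Real.norm_of_nonneg hγ.le, ← mul_assoc] at h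
  calc (1 - 24 * L * γ) ^ 2 * ‖M - gradient F (θ - γ • R)‖ ^ 2
      ≤ (1 - 24 * L * γ) ^ 2 * (‖M - gradient F θ‖ + L * γ * ‖R‖) ^ 2 := by
        gcongr
        rw [← sub_sub_sub_cancel_right M _ (gradient F θ)]
        exact (norm_sub_le _ _).trans (add_le_add_right drift _)
    _ ≤ (1 - 24 * L * γ) * ‖M - gradient F θ‖ ^ 2
          + (L * γ * ‖R‖) ^ 2 / (1 - (1 - 24 * L * γ)) :=
        sq_mul_add_sq_le (sub_nonneg.2 hγL) (sub_lt_self 1 (by positivity)) _ _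
    _ = (1 - 24 * L * γ) * ‖M - gradient F θ‖ ^ 2 + L * γ / 24 * ‖R‖ ^ 2 := by
        field_simp
        ring

/-- The left-hand side is the expected Lyapunov function after the step, without the contribution
of the noise in the fresh gradients. -/
theorem IsSmooth.lyapunov_step_le (hs : IsSmooth L F) (hc : IsStronglyConvex μ F) (hL : 0 < L)
    (hμ : 0 < μ) (hμL : μ ≤ L) (hγ : 0 < γ) (hγL : 24 * L * γ ≤ 1) (θ M R : E d) :
    F (θ - γ • R) - (⨅ y, F y)
        + L⁻¹ * ((1 - 24 * L * γ) ^ 2 * ‖M - gradient F (θ - γ • R)‖ ^ 2)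
      ≤ (1 - μ * γ) * lyapunov L F θ M + γ * ‖R - M‖ ^ 2 := by
  have descent := hs.le_of_inexact_step γ θ R
  have polyak := mul_le_mul_of_nonneg_left (hc.sub_iInf_le_norm_gradient_sq hμ θ) hγ.le
  have split : γ * ‖R - gradient F θ‖ ^ 2
      ≤ γ * (2 * ‖R - M‖ ^ 2 + 2 * ‖M - gradient F θ‖ ^ 2) := by
    rw [← sub_add_sub_cancel R M]
    exact mul_le_mul_of_nonneg_left (norm_add_sq_le_two_mul _ _) hγ.le
  have tracking : L⁻¹ * ((1 - 24 * L * γ) ^ 2 * ‖M - gradient F (θ - γ • R)‖ ^ 2)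
      ≤ L⁻¹ * ‖M - gradient F θ‖ ^ 2 - 24 * γ * ‖M - gradient F θ‖ ^ 2 + γ / 24 * ‖R‖ ^ 2 := by
    refine (mul_le_mul_of_nonneg_left
      (hs.norm_sub_gradient_step_sq_le hc hL hμ.le hγ hγL θ M R) (by positivity)).trans_eq ?_
    field_simp
  have rate : μ * γ * (L⁻¹ * ‖M - gradient F θ‖ ^ 2) ≤ γ * ‖M - gradient F θ‖ ^ 2 := by
    have hratio : μ * L⁻¹ ≤ 1 := mul_inv_le_one_of_le₀ hμL hL.le
    linarith [mul_le_mul_of_nonneg_right hratio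
      (by positivity : 0 ≤ γ * ‖M - gradient F θ‖ ^ 2)]
  have step : γ * (L * γ) * ‖R‖ ^ 2 ≤ γ / 24 * ‖R‖ ^ 2 := by
    gcongr
    nlinarith
  have : 0 ≤ γ * ‖R‖ ^ 2 := by positivity
  have : 0 ≤ γ * ‖M - gradient F θ‖ ^ 2 := by positivity
  unfold lyapunov
  linarith

end Optimization

/-! ### Mean and spread of a finite family -/

section Mean

variable {ι V : Type*} {s : Finset ι}

/-- Average of the family `x` over `s`; it is `0` for empty `s`. -/
def mean [AddCommGroup V] [Module ℝ V] (s : Finset ι) (x : ι → V) : V :=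
  (s.card : ℝ)⁻¹ • ∑ i ∈ s, x i

section Module

variable [AddCommGroup V] [Module ℝ V] {x y : ι → V}

theorem mean_congr (h : ∀ i ∈ s, x i = y i) : mean s x = mean s y := by
  rw [mean, mean, Finset.sum_congr rfl h]

theorem mean_add (s : Finset ι) (x y : ι → V) :
    mean s (fun i => x i + y i) = mean s x + mean s y := by
  simp only [mean, Finset.sum_add_distrib, smul_add]

theorem mean_smul (s : Finset ι) (c : ℝ) (x : ι → V) :
    mean s (fun i => c • x i) = c • mean s x := by
  simp only [mean, ← Finset.smul_sum, smul_comm c]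

theorem mean_const (hs : s.Nonempty) (c : V) : mean s (fun _ => c) = c := by
  rw [mean, Finset.sum_const, ← Nat.cast_smul_eq_nsmul ℝ, inv_smul_smul₀]
  exact Nat.cast_ne_zero.2 hs.card_pos.ne'

theorem mean_sub_const (hs : s.Nonempty) (x : ι → V) (c : V) :
    mean s (fun i => x i - c) = mean s x - c := by
  simp only [sub_eq_add_neg, mean_add, mean_const hs]

theorem card_smul_mean (s : Finset ι) (x : ι → V) : (s.card : ℝ) • mean s x = ∑ i ∈ s, x i := by
  rcases s.eq_empty_or_nonempty with rfl | hs
  · simp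
  · exact smul_inv_smul₀ (Nat.cast_ne_zero.2 hs.card_pos.ne') _

theorem sum_sub_mean (s : Finset ι) (x : ι → V) : ∑ i ∈ s, (x i - mean s x) = 0 := by
  rw [Finset.sum_sub_distrib, Finset.sum_const, ← Nat.cast_smul_eq_nsmul ℝ, card_smul_mean,
    sub_self]

end Module

theorem mean_mono {x y : ι → ℝ} (h : ∀ i ∈ s, x i ≤ y i) : mean s x ≤ mean s y :=
  smul_le_smul_of_nonneg_left (Finset.sum_le_sum h) (by positivity)

theorem mean_nonneg {x : ι → ℝ} (h : ∀ i ∈ s, 0 ≤ x i) : 0 ≤ mean s x :=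
  smul_nonneg (by positivity) (Finset.sum_nonneg h)

theorem mean_le_of_forall_le {x : ι → ℝ} {c : ℝ} (hc : 0 ≤ c) (h : ∀ i ∈ s, x i ≤ c) :
    mean s x ≤ c := by
  rcases s.eq_empty_or_nonempty with rfl | hs
  · simpa [mean] using hc
  · exact (mean_mono h).trans_eq (mean_const hs c)

variable [NormedAddCommGroup V] [InnerProductSpace ℝ V] {x y : ι → V}

/-- Mean squared deviation of the family `x` over `s` from its mean. -/
def spread (s : Finset ι) (x : ι → V) : ℝ :=
  mean s fun i => ‖x i - mean s x‖ ^ 2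

theorem spread_nonneg (s : Finset ι) (x : ι → V) : 0 ≤ spread s x :=
  mean_nonneg fun _ _ => sq_nonneg _

theorem spread_congr (h : ∀ i ∈ s, x i = y i) : spread s x = spread s y := by
  rw [spread, spread, mean_congr h]
  exact mean_congr fun i hi => by rw [h i hi]

theorem spread_zero (s : Finset ι) : spread s (0 : ι → V) = 0 := by
  simp [spread, mean]

theorem spread_le_mean_norm_sq (s : Finset ι) (x : ι → V) :
    spread s x ≤ mean s fun i => ‖x i‖ ^ 2 := by
  have cross : ∑ i ∈ s, inner ℝ (x i - mean s x) (mean s x) = 0 := by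
    rw [← sum_inner, sum_sub_mean, inner_zero_left]
  refine smul_le_smul_of_nonneg_left ?_ (by positivity)
  calc ∑ i ∈ s, ‖x i - mean s x‖ ^ 2
      = ∑ i ∈ s, (‖x i‖ ^ 2 - ‖mean s x‖ ^ 2 - 2 * inner ℝ (x i - mean s x) (mean s x)) :=
        Finset.sum_congr rfl fun i _ => by
          rw [norm_sub_sq_real, inner_sub_left, real_inner_self_eq_norm_sq]
          ring
    _ = ∑ i ∈ s, (‖x i‖ ^ 2 - ‖mean s x‖ ^ 2) := by
        rw [Finset.sum_sub_distrib, ← Finset.mul_sum, cross, mul_zero, sub_zero]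
    _ ≤ ∑ i ∈ s, ‖x i‖ ^ 2 := Finset.sum_le_sum fun i _ => sub_le_self _ (sq_nonneg _)

theorem norm_mean_sq_le (s : Finset ι) (x : ι → V) :
    ‖mean s x‖ ^ 2 ≤ mean s fun i => ‖x i‖ ^ 2 := by
  rcases s.eq_empty_or_nonempty with rfl | hs
  · simp [mean]
  have : (0 : ℝ) < s.card := Nat.cast_pos.2 hs.card_pos
  calc ‖mean s x‖ ^ 2 = (s.card : ℝ)⁻¹ ^ 2 * ‖∑ i ∈ s, x i‖ ^ 2 := by
        rw [mean, norm_smul, mul_pow, norm_inv, Real.norm_natCast]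
    _ ≤ (s.card : ℝ)⁻¹ ^ 2 * (s.card * ∑ i ∈ s, ‖x i‖ ^ 2) := by
        gcongr
        exact (pow_le_pow_left₀ (norm_nonneg _) (norm_sum_le s x) 2).trans
          sq_sum_le_card_mul_sum_sq
    _ = mean s fun i => ‖x i‖ ^ 2 := by
        rw [mean, smul_eq_mul]
        field_simp

theorem norm_smul_add_smul_sq_le {a : ℝ} (ha : 0 ≤ a) (ha' : a ≤ 1) (v w : V) :
    ‖a • v + (1 - a) • w‖ ^ 2 ≤ a * ‖v‖ ^ 2 + (1 - a) * ‖w‖ ^ 2 :=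
  (convexOn_univ_norm.pow (fun _ _ => norm_nonneg _) 2).2 trivial trivial ha (sub_nonneg.2 ha')
    (add_sub_cancel a 1)

theorem spread_smul_add_smul_le {a : ℝ} (ha : 0 ≤ a) (ha' : a ≤ 1) (s : Finset ι) (x y : ι → V) :
    spread s (fun i => a • x i + (1 - a) • y i) ≤ a * spread s x + (1 - a) * spread s y := by
  simp only [spread, ← smul_eq_mul, ← mean_smul, ← mean_add]
  refine mean_mono fun i _ => ?_
  rw [mean_add, mean_smul, mean_smul, add_sub_add_comm, ← smul_sub, ← smul_sub]
  exact norm_smul_add_smul_sq_le ha ha' _ _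

end Mean

/-! ### Robust averaging by trimming -/

section TrimmedMean

open Finset

theorem sum_sq_sdiff_le {ι : Type*} [Fintype ι] [DecidableEq ι] {H lo I hi : Finset ι} {y : ι → ℝ}
    (hlo : ∀ i ∈ lo, ∀ j ∈ I, y i ≤ y j) (hhi : ∀ i ∈ I, ∀ j ∈ hi, y i ≤ y j)
    (dlo : Disjoint lo I) (dhi : Disjoint hi I) (clo : Hᶜ.card ≤ lo.card)
    (chi : Hᶜ.card ≤ hi.card) :
    ∑ i ∈ I \ H, y i ^ 2 ≤ ∑ i ∈ H \ I, y i ^ 2 := by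
  rcases (I \ H).eq_empty_or_nonempty with h | h
  · rw [h, sum_empty]
    positivity
  obtain ⟨k, hk, hmax⟩ := exists_max_image (I \ H) (fun i => y i ^ 2) h
  have hkI := (mem_sdiff.1 hk).1
  -- A discarded block contains at least `#(I \ H)` elements of `H`, since `Hᶜ` is small.
  have of_block (S : Finset ι) (dS : Disjoint S I) (cS : Hᶜ.card ≤ S.card)
      (hS : ∀ i ∈ S, y k ^ 2 ≤ y i ^ 2) : ∑ i ∈ I \ H, y i ^ 2 ≤ ∑ i ∈ H \ I, y i ^ 2 := by
    have card_le : (I \ H).card ≤ (S ∩ H).card := by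
      have hunion : (S \ H ∪ I \ H).card ≤ Hᶜ.card :=
        card_le_card fun i hi => mem_compl.2 (by grind)
      rw [card_union_of_disjoint (dS.mono sdiff_subset sdiff_subset)] at hunion
      have := card_sdiff_add_card_inter S H
      omega
    calc ∑ i ∈ I \ H, y i ^ 2 ≤ (I \ H).card • y k ^ 2 := sum_le_card_nsmul _ _ _ hmax
      _ ≤ (S ∩ H).card • y k ^ 2 := nsmul_le_nsmul_left (sq_nonneg _) card_le
      _ ≤ ∑ i ∈ S ∩ H, y i ^ 2 :=
          card_nsmul_le_sum _ _ _ fun i hi => hS i (mem_of_mem_inter_left hi)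
      _ ≤ ∑ i ∈ H \ I, y i ^ 2 := by
          refine sum_le_sum_of_subset_of_nonneg (fun i hi => ?_) fun _ _ _ => sq_nonneg _
          rw [mem_inter] at hi
          exact mem_sdiff.2 ⟨hi.2, disjoint_left.1 dS hi.1⟩
  rcases le_total 0 (y k) with h0 | h0
  · exact of_block hi dhi chi fun i hi => pow_le_pow_left₀ h0 (hhi k hkI i hi) 2
  · exact of_block lo dlo clo fun i hi => by nlinarith [hlo i hi k hkI]

theorem sq_sum_le_of_sum_eq_zero {ι : Type*} [DecidableEq ι] {H I : Finset ι} {y : ι → ℝ} {f : ℕ}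
    (hzero : ∑ i ∈ H, y i = 0) (cIH : (I \ H).card ≤ f) (cHI : (H \ I).card ≤ 2 * f)
    (hsq : ∑ i ∈ I \ H, y i ^ 2 ≤ ∑ i ∈ H \ I, y i ^ 2) :
    (∑ i ∈ I, y i) ^ 2 ≤ 6 * f * ∑ i ∈ H, y i ^ 2 := by
  have hsum : ∑ i ∈ I, y i = ∑ i ∈ I \ H, y i + -∑ i ∈ H \ I, y i := by
    linarith [sum_sdiff_sub_sum_sdiff (s₁ := I) (s₂ := H) (f := y)]
  have hHI : ∑ i ∈ H \ I, y i ^ 2 ≤ ∑ i ∈ H, y i ^ 2 :=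
    sum_le_sum_of_subset_of_nonneg sdiff_subset fun _ _ _ => sq_nonneg _
  have bound (S : Finset ι) (k : ℕ) (hk : S.card ≤ k) (hS : ∑ i ∈ S, y i ^ 2 ≤ ∑ i ∈ H, y i ^ 2) :
      (∑ i ∈ S, y i) ^ 2 ≤ k * ∑ i ∈ H, y i ^ 2 :=
    sq_sum_le_card_mul_sum_sq.trans (by gcongr)
  have hIH := bound _ _ cIH (hsq.trans hHI)
  have hHI' := bound _ _ cHI hHI
  push_cast at hHI'
  calc (∑ i ∈ I, y i) ^ 2 ≤ 2 * ((∑ i ∈ I \ H, y i) ^ 2 + (-∑ i ∈ H \ I, y i) ^ 2) :=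
        hsum ▸ add_sq_le
    _ ≤ 6 * f * ∑ i ∈ H, y i ^ 2 := by rw [neg_sq]; linarith

variable {n d f : ℕ}

/-- Indices of the entries of `x` whose rank in increasing order lies in `[a, b)`, ranks being
counted from `0` and ties broken by `Tuple.sort`. -/
def rankBlock (x : Fin n → ℝ) (a b : ℕ) : Finset (Fin n) :=
  (univ.filter fun r : Fin n => a ≤ (r : ℕ) ∧ (r : ℕ) < b).map (Tuple.sort x).toEmbedding

theorem card_rankBlock (x : Fin n → ℝ) {a b : ℕ} (hb : b ≤ n) : (rankBlock x a b).card = b - a := by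
  rw [rankBlock, card_map, ← Nat.card_Ico, ← card_map Fin.valEmbedding]
  congr 1
  ext k
  simp only [mem_map, mem_filter, mem_univ, true_and, Fin.valEmbedding_apply, mem_Ico]
  exact ⟨fun ⟨_, hr, hrk⟩ => hrk ▸ hr, fun hk => ⟨⟨k, hk.2.trans_le hb⟩, hk, rfl⟩⟩

theorem disjoint_rankBlock (x : Fin n → ℝ) {a b a' b' : ℕ} (h : b ≤ a') :
    Disjoint (rankBlock x a b) (rankBlock x a' b') := by
  rw [rankBlock, rankBlock, disjoint_map, disjoint_filter]
  omega

theorem le_of_mem_rankBlock {x : Fin n → ℝ} {a b a' b' : ℕ} (h : b ≤ a') {i j : Fin n}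
    (hi : i ∈ rankBlock x a b) (hj : j ∈ rankBlock x a' b') : x i ≤ x j := by
  simp only [rankBlock, mem_map, mem_filter, Equiv.coe_toEmbedding] at hi hj
  obtain ⟨r, hr, rfl⟩ := hi
  obtain ⟨r', hr', rfl⟩ := hj
  exact Tuple.monotone_sort x (Fin.le_def.2 (by omega))

theorem cast_card_rankBlock_trim (hf : 2 * f ≤ n) (x : Fin n → ℝ) :
    ((rankBlock x f (n - f)).card : ℝ) = n - 2 * f := by
  rw [card_rankBlock x (Nat.sub_le n f), Nat.sub_sub, ← two_mul, Nat.cast_sub hf]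
  push_cast
  ring

theorem trimmedMean_eq_mean_rankBlock (hf : 2 * f ≤ n) (x : Fin n → ℝ) :
    trimmedMean f x = mean (rankBlock x f (n - f)) x := by
  rw [mean, cast_card_rankBlock_trim hf, rankBlock, sum_map, trimmedMean, smul_eq_mul]
  simp only [Nat.lt_sub_iff_add_lt, Equiv.coe_toEmbedding]

theorem sq_sum_rankBlock_sub_mean_le (hf : 2 * f ≤ n) {S : Finset (Fin n)} (hS : S.card = n - f)
    (x : Fin n → ℝ) :
    (∑ i ∈ rankBlock x f (n - f), (x i - mean S x)) ^ 2
      ≤ 6 * f * ∑ i ∈ S, (x i - mean S x) ^ 2 := by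
  set I := rankBlock x f (n - f)
  have hcompl : Sᶜ.card = f := by
    rw [card_compl, Fintype.card_fin]
    omega
  have hIS : (I \ S).card ≤ f :=
    hcompl ▸ card_le_card fun i hi => mem_compl.2 (mem_sdiff.1 hi).2
  have hSI : (S \ I).card ≤ 2 * f := by
    have hI : I.card = n - f - f := card_rankBlock x (Nat.sub_le n f)
    have := card_sdiff_add_card S I
    have := card_sdiff_add_card I S
    rw [union_comm] at this
    omega
  refine sq_sum_le_of_sum_eq_zero (sum_sub_mean S x) hIS hSI
    (sum_sq_sdiff_le (lo := rankBlock x 0 f) (hi := rankBlock x (n - f) n)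
      (fun i hi j hj => sub_le_sub_right (le_of_mem_rankBlock le_rfl hi hj) _)
      (fun i hi j hj => sub_le_sub_right (le_of_mem_rankBlock le_rfl hi hj) _)
      (disjoint_rankBlock x le_rfl) (disjoint_rankBlock x le_rfl).symm ?_ ?_)
  · rw [hcompl, card_rankBlock x (by omega), Nat.sub_zero]
  · rw [hcompl, card_rankBlock x le_rfl]
    omega

/-- Robustness coefficient of the trimmed mean that discards `2 * f` of `n` values. -/
def trimCoeff (n f : ℕ) : ℝ := 6 * f * ((n : ℝ) - f) / ((n : ℝ) - 2 * f) ^ 2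

theorem trimCoeff_nonneg (hf : f ≤ n) : 0 ≤ trimCoeff n f := by
  have : (0 : ℝ) ≤ n - f := sub_nonneg.2 (Nat.cast_le.2 hf)
  unfold trimCoeff
  positivity

theorem sq_trimmedMean_sub_mean_le (hf : 2 * f < n) {S : Finset (Fin n)} (hS : S.card = n - f)
    (x : Fin n → ℝ) : (trimmedMean f x - mean S x) ^ 2 ≤ trimCoeff n f * spread S x := by
  set I := rankBlock x f (n - f) with hI
  have hIne : I.Nonempty := card_pos.1 (by rw [hI, card_rankBlock x (Nat.sub_le n f)]; omega)
  have hScard : (S.card : ℝ) = n - f := by rw [hS, Nat.cast_sub (by omega)]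
  calc (trimmedMean f x - mean S x) ^ 2
      = ((n : ℝ) - 2 * f)⁻¹ ^ 2 * (∑ i ∈ I, (x i - mean S x)) ^ 2 := by
        rw [trimmedMean_eq_mean_rankBlock hf.le, ← mean_sub_const hIne, mean,
          cast_card_rankBlock_trim hf.le, smul_eq_mul, mul_pow]
    _ ≤ ((n : ℝ) - 2 * f)⁻¹ ^ 2 * (6 * f * ∑ i ∈ S, (x i - mean S x) ^ 2) := by
        gcongr
        exact sq_sum_rankBlock_sub_mean_le hf.le hS x
    _ = ((n : ℝ) - 2 * f)⁻¹ ^ 2 * (6 * f * (S.card * spread S x)) := by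
        rw [spread, ← smul_eq_mul (S.card : ℝ), card_smul_mean]
        simp only [Real.norm_eq_abs, sq_abs]
    _ = trimCoeff n f * spread S x := by
        rw [trimCoeff, hScard, inv_pow]
        ring

/-- `agg` is an `(f, κ)`-robust averaging rule: among any inputs, its output is as close to the mean
of any `n - f` of them as a multiple `κ` of their spread allows. -/
def IsRobustAveraging (f : ℕ) (κ : ℝ) (agg : (Fin n → E d) → E d) : Prop :=
  ∀ S : Finset (Fin n), S.card = n - f → ∀ x, ‖agg x - mean S x‖ ^ 2 ≤ κ * spread S x

theorem isRobustAveraging_cwtm (hf : 2 * f < n) :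
    IsRobustAveraging f (trimCoeff n f) (cwtm (n := n) (d := d) f) := by
  intro S hS x
  have mean_apply (k : Fin d) : mean S x k = mean S fun i => x i k := by simp [mean]
  have spread_eq : spread S x = ∑ k, spread S fun i => x i k := by
    simp only [spread, mean, EuclideanSpace.real_norm_sq_eq, Real.norm_eq_abs, sq_abs,
      ← smul_sum, sum_comm (s := S)]
    simp
  rw [spread_eq, mul_sum, EuclideanSpace.real_norm_sq_eq]
  refine sum_le_sum fun k _ => ?_
  rw [PiLp.sub_apply, mean_apply]
  exact sq_trimmedMean_sub_mean_le hf hS fun i => x i k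

end TrimmedMean

/-! ### Second moments of random vectors -/

section Moments

variable {Ω Ω' ι V : Type*} [MeasurableSpace Ω] [MeasurableSpace Ω'] {P : Measure Ω}
  {s : Finset ι}

theorem integral_comp_measurePreserving [NormedAddCommGroup V] [NormedSpace ℝ V] {P' : Measure Ω'}
    {T : Ω → Ω'} (hT : MeasurePreserving T P P') {g : Ω' → V} (hg : AEStronglyMeasurable g P') :
    ∫ ω, g (T ω) ∂P = ∫ ω, g ω ∂P' := by
  rw [← hT.map_eq, integral_map hT.measurable.aemeasurable (by rwa [hT.map_eq])]

theorem integrable_norm_sq [NormedAddCommGroup V] {Y : Ω → V} (hY : MemLp Y 2 P) :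
    Integrable (fun ω => ‖Y ω‖ ^ 2) P :=
  hY.integrable_norm_pow two_ne_zero

theorem integral_norm_add_sq_le [NormedAddCommGroup V] {Y Z : Ω → V} (hY : MemLp Y 2 P)
    (hZ : MemLp Z 2 P) :
    ∫ ω, ‖Y ω + Z ω‖ ^ 2 ∂P ≤ 2 * ∫ ω, ‖Y ω‖ ^ 2 ∂P + 2 * ∫ ω, ‖Z ω‖ ^ 2 ∂P := by
  have hY2 := (integrable_norm_sq hY).const_mul 2
  have hZ2 := (integrable_norm_sq hZ).const_mul 2
  rw [← integral_const_mul, ← integral_const_mul, ← integral_add hY2 hZ2]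
  exact integral_mono (integrable_norm_sq (hY.add hZ)) (hY2.add hZ2)
    fun ω => norm_add_sq_le_two_mul _ _

section Mean

variable [NormedAddCommGroup V] [NormedSpace ℝ V] {X : ι → Ω → V}

theorem memLp_mean {p : ENNReal} (hX : ∀ i ∈ s, MemLp (X i) p P) :
    MemLp (fun ω => mean s fun i => X i ω) p P :=
  (memLp_finsetSum s hX).const_smul (s.card : ℝ)⁻¹

theorem integrable_mean (hX : ∀ i ∈ s, Integrable (X i) P) :
    Integrable (fun ω => mean s fun i => X i ω) P :=
  (integrable_finsetSum s hX).smul (s.card : ℝ)⁻¹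

theorem integral_mean (hX : ∀ i ∈ s, Integrable (X i) P) :
    ∫ ω, mean s (fun i => X i ω) ∂P = mean s fun i => ∫ ω, X i ω ∂P := by
  simp only [mean]
  rw [integral_smul, integral_finsetSum s hX]

theorem integral_mean_eq_zero (hX : ∀ i ∈ s, Integrable (X i) P)
    (h0 : ∀ i ∈ s, ∫ ω, X i ω ∂P = 0) : ∫ ω, mean s (fun i => X i ω) ∂P = 0 := by
  rw [integral_mean hX, mean, Finset.sum_eq_zero h0, smul_zero]

theorem memLp_const_add_smul [IsFiniteMeasure P] {Y : Ω → V} (hY : MemLp Y 2 P) (w : V) (c : ℝ) :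
    MemLp (fun ω => w + c • Y ω) 2 P :=
  (memLp_const w).add (hY.const_smul c)

end Mean

theorem integral_mean_norm_sq_le [NormedAddCommGroup V] {X : ι → Ω → V} {v : ℝ}
    (hX : ∀ i ∈ s, MemLp (X i) 2 P) (hv : 0 ≤ v)
    (h : ∀ i ∈ s, ∫ ω, ‖X i ω‖ ^ 2 ∂P ≤ v) :
    ∫ ω, mean s (fun i => ‖X i ω‖ ^ 2) ∂P ≤ v := by
  rw [integral_mean fun i hi => integrable_norm_sq (hX i hi)]
  exact mean_le_of_forall_le hv h

variable [NormedAddCommGroup V] [InnerProductSpace ℝ V] {X : ι → Ω → V}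

theorem integrable_inner {Y Z : Ω → V} (hY : MemLp Y 2 P) (hZ : MemLp Z 2 P) :
    Integrable (fun ω => inner ℝ (Y ω) (Z ω)) P :=
  (hY.norm.integrable_mul hZ.norm).mono (hY.aestronglyMeasurable.inner hZ.aestronglyMeasurable)
    (.of_forall fun ω => (norm_inner_le_norm _ _).trans_eq (by simp))

theorem integral_norm_sum_sq_of_orthogonal (hX : ∀ i ∈ s, MemLp (X i) 2 P)
    (horth : ∀ i ∈ s, ∀ j ∈ s, i ≠ j → ∫ ω, inner ℝ (X i ω) (X j ω) ∂P = 0) :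
    ∫ ω, ‖∑ i ∈ s, X i ω‖ ^ 2 ∂P = ∑ i ∈ s, ∫ ω, ‖X i ω‖ ^ 2 ∂P := by
  simp only [← real_inner_self_eq_norm_sq, inner_sum, sum_inner]
  rw [integral_finsetSum _ fun j hj => integrable_finsetSum _ fun i hi =>
    integrable_inner (hX i hi) (hX j hj)]
  refine Finset.sum_congr rfl fun j hj => ?_
  rw [integral_finsetSum _ fun i hi => integrable_inner (hX i hi) (hX j hj)]
  exact Finset.sum_eq_single_of_mem j hj fun i hi hij => horth i hi j hj hij

theorem integral_inner_eq_zero_of_comp_eq_neg {Y Z : Ω → V} (hY : AEStronglyMeasurable Y P)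
    (hZ : AEStronglyMeasurable Z P) {T : Ω → Ω} (hT : MeasurePreserving T P P)
    (hYT : ∀ ω, Y (T ω) = -Y ω) (hZT : ∀ ω, Z (T ω) = Z ω) :
    ∫ ω, inner ℝ (Y ω) (Z ω) ∂P = 0 := by
  have h := integral_comp_measurePreserving hT (hY.inner (𝕜 := ℝ) hZ)
  simp only [hYT, hZT, inner_neg_left, integral_neg] at h
  linarith

theorem memLp_sub_mean (hX : ∀ i ∈ s, MemLp (X i) 2 P) :
    ∀ i ∈ s, MemLp (fun ω => X i ω - mean s fun j => X j ω) 2 P :=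
  fun i hi => (hX i hi).sub (memLp_mean hX)

theorem integrable_spread (hX : ∀ i ∈ s, MemLp (X i) 2 P) :
    Integrable (fun ω => spread s fun i => X i ω) P :=
  integrable_mean fun i hi => integrable_norm_sq (memLp_sub_mean hX i hi)

variable [CompleteSpace V] [IsProbabilityMeasure P]

theorem integral_norm_const_add_smul_sq {Y : Ω → V} (hY : MemLp Y 2 P) (h0 : ∫ ω, Y ω ∂P = 0)
    (w : V) (c : ℝ) :
    ∫ ω, ‖w + c • Y ω‖ ^ 2 ∂P = ‖w‖ ^ 2 + c ^ 2 * ∫ ω, ‖Y ω‖ ^ 2 ∂P := by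
  have hY1 : Integrable Y P := hY.integrable one_le_two
  have expand (ω : Ω) :
      ‖w + c • Y ω‖ ^ 2 = ‖w‖ ^ 2 + 2 * c * inner ℝ w (Y ω) + c ^ 2 * ‖Y ω‖ ^ 2 := by
    rw [norm_add_sq_real, real_inner_smul_right, norm_smul, mul_pow, Real.norm_eq_abs, sq_abs]
    ring
  have hcross : Integrable (fun ω => 2 * c * inner ℝ w (Y ω)) P := (hY1.const_inner w).const_mul _
  have hlin : Integrable (fun ω => ‖w‖ ^ 2 + 2 * c * inner ℝ w (Y ω)) P :=
    (integrable_const _).add hcross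
  simp only [expand]
  rw [integral_add hlin ((integrable_norm_sq hY).const_mul _),
    integral_add (integrable_const _) hcross, integral_const_mul, integral_const_mul,
    integral_inner hY1, h0, inner_zero_right, integral_const, probReal_univ, one_smul, mul_zero,
    add_zero]

theorem integral_spread_const_add_smul (hX : ∀ i ∈ s, MemLp (X i) 2 P)
    (h0 : ∀ i ∈ s, ∫ ω, X i ω ∂P = 0) (w : ι → V) (c : ℝ) :
    ∫ ω, spread s (fun i => w i + c • X i ω) ∂P
      = spread s w + c ^ 2 * ∫ ω, spread s (fun i => X i ω) ∂P := by
  have hX1 i (hi : i ∈ s) : Integrable (X i) P := (hX i hi).integrable one_le_two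
  have centered : ∀ i ∈ s, ∫ ω, (X i ω - mean s fun j => X j ω) ∂P = 0 := fun i hi => by
    rw [integral_sub (hX1 i hi) (integrable_mean hX1), h0 i hi, integral_mean_eq_zero hX1 h0,
      sub_zero]
  have hdev := memLp_sub_mean hX
  calc ∫ ω, spread s (fun i => w i + c • X i ω) ∂P
      = ∫ ω, mean s (fun i =>
          ‖(w i - mean s w) + c • (X i ω - mean s fun j => X j ω)‖ ^ 2) ∂P := by
        simp only [spread, mean_add, mean_smul, add_sub_add_comm, smul_sub]
    _ = mean s fun i => ‖w i - mean s w‖ ^ 2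
          + c ^ 2 * ∫ ω, ‖X i ω - mean s fun j => X j ω‖ ^ 2 ∂P := by
        rw [integral_mean fun i hi => integrable_norm_sq (memLp_const_add_smul (hdev i hi) _ _)]
        exact mean_congr fun i hi => integral_norm_const_add_smul_sq (hdev i hi) (centered i hi) _ _
    _ = spread s w + c ^ 2 * ∫ ω, spread s (fun i => X i ω) ∂P := by
        simp only [← smul_eq_mul (c ^ 2), mean_add, mean_smul, spread]
        rw [integral_mean fun i hi => integrable_norm_sq (hdev i hi)]

end Moments

/-! ### Uniform mini-batches -/

section Batch

open Finset

theorem sum_powersetCard_sum {α V : Type*} [AddCommMonoid V] (s : Finset α)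
    {b : ℕ} (hb : 1 ≤ b) (a : α → V) :
    ∑ S ∈ s.powersetCard b, ∑ j ∈ S, a j = (s.card - 1).choose (b - 1) • ∑ j ∈ s, a j := by
  classical
  have indicator : ∀ S ∈ s.powersetCard b, ∑ j ∈ S, a j = ∑ j ∈ s, if j ∈ S then a j else 0 :=
    fun S hS => by
      rw [← sum_filter, filter_mem_eq_inter, inter_eq_right.2 (mem_powersetCard.1 hS).1]
  rw [sum_congr rfl indicator, sum_comm, smul_sum]
  refine sum_congr rfl fun j hj => ?_
  have count := card_filter_powersetCard_subset {j} s b (singleton_subset_iff.2 hj) (by simpa)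
  simp only [singleton_subset_iff, card_singleton] at count
  rw [← sum_filter, sum_const, count]

variable {m b : ℕ}

theorem isProbabilityMeasure_batchLaw (hbm : b ≤ m) : IsProbabilityMeasure (batchLaw m b) :=
  isProbabilityMeasure_uniformOn (finite_toSet _) (by
    rwa [coe_nonempty, powersetCard_nonempty, card_univ, Fintype.card_fin])

theorem ae_card_batchLaw : ∀ᵐ S ∂(batchLaw m b), S.card = b := by
  rw [batchLaw, uniformOn]
  filter_upwards [ae_cond_mem (Set.toFinite _).measurableSet] with S hS
  exact (mem_powersetCard.1 (mem_coe.1 hS)).2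

variable {V : Type*} [NormedAddCommGroup V] [NormedSpace ℝ V] [CompleteSpace V]

theorem integral_batchLaw (g : Finset (Fin m) → V) :
    ∫ S, g S ∂(batchLaw m b) = mean (univ.powersetCard b) g := by
  rw [batchLaw, uniformOn, ProbabilityTheory.cond, integral_smul_measure,
    setIntegral_finset _ (Integrable.of_finite)]
  simp [Measure.count_apply_finset, mean]

theorem integral_batchLaw_mean (hb : 1 ≤ b) (hbm : b ≤ m) (a : Fin m → V) :
    ∫ S, mean S a ∂(batchLaw m b) = mean univ a := by
  have batch_mean : ∀ S ∈ (univ : Finset (Fin m)).powersetCard b,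
      mean S a = (b : ℝ)⁻¹ • ∑ j ∈ S, a j := fun S hS => by
    rw [mean, (mem_powersetCard.1 hS).2]
  have choose_mul : (m : ℝ) * (m - 1).choose (b - 1) = m.choose b * b := by
    have h := Nat.add_one_mul_choose_eq (m - 1) (b - 1)
    rw [Nat.sub_add_cancel hb, Nat.sub_add_cancel (hb.trans hbm)] at h
    exact_mod_cast h
  have choose_ne : (m.choose b : ℝ) ≠ 0 := mod_cast (Nat.choose_pos hbm).ne'
  have hb0 : (b : ℝ) ≠ 0 := mod_cast (Nat.one_le_iff_ne_zero.1 hb)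
  have hm0 : (m : ℝ) ≠ 0 := mod_cast (Nat.one_le_iff_ne_zero.1 (hb.trans hbm))
  rw [integral_batchLaw, mean_congr batch_mean, mean_smul, mean, sum_powersetCard_sum _ hb, mean,
    card_powersetCard, card_univ, Fintype.card_fin, ← Nat.cast_smul_eq_nsmul ℝ, smul_smul,
    smul_smul]
  congr 1
  field_simp
  linarith

end Batch

/-! ### Gaussian vectors -/

section Gaussian

variable {d : ℕ} {s : ℝ}

instance isProbabilityMeasure_gaussianLaw : IsProbabilityMeasure (gaussianLaw d s) :=
  Measure.isProbabilityMeasure_map (by fun_prop)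

theorem measurePreserving_neg_gaussianLaw :
    MeasurePreserving (fun z : E d => -z) (gaussianLaw d s) (gaussianLaw d s) := by
  refine ⟨measurable_neg, ?_⟩
  have h := stdGaussian_map (LinearIsometryEquiv.neg ℝ (E := E d))
  conv_rhs => rw [gaussianLaw, ← h, Measure.map_map (by fun_prop) (by fun_prop)]
  rw [gaussianLaw, Measure.map_map (by fun_prop) (by fun_prop)]
  congr 1
  ext z : 1
  simp

theorem memLp_gaussianLaw : MemLp (fun z : E d => z) 2 (gaussianLaw d s) := by
  rw [gaussianLaw, memLp_map_measure_iff (by fun_prop) (by fun_prop)]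
  exact (IsGaussian.memLp_two_id (μ := stdGaussian (E d))).const_smul (√s)

theorem integral_id_gaussianLaw : ∫ z, z ∂(gaussianLaw d s) = 0 := by
  rw [gaussianLaw, integral_map (by fun_prop) (by fun_prop), integral_smul,
    integral_id_stdGaussian, smul_zero]

theorem integral_sq_apply_stdGaussian (k : Fin d) :
    ∫ z : E d, z k ^ 2 ∂(stdGaussian (E d)) = 1 := by
  have hv := variance_dual_stdGaussian (innerSL ℝ (EuclideanSpace.single k (1 : ℝ) : E d))
  rw [variance_of_integral_eq_zero (by fun_prop) (integral_strongDual_stdGaussian _)] at hv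
  simpa [EuclideanSpace.inner_single_left] using hv

theorem integral_norm_sq_stdGaussian : ∫ z, ‖z‖ ^ 2 ∂(stdGaussian (E d)) = d := by
  have hint (k : Fin d) : Integrable (fun z : E d => z k ^ 2) (stdGaussian (E d)) :=
    .of_integral_ne_zero (by rw [integral_sq_apply_stdGaussian]; exact one_ne_zero)
  simp_rw [EuclideanSpace.real_norm_sq_eq]
  rw [integral_finsetSum _ fun k _ => hint k]
  simp [integral_sq_apply_stdGaussian]

theorem integral_norm_sq_gaussianLaw (hs : 0 ≤ s) :
    ∫ z, ‖z‖ ^ 2 ∂(gaussianLaw d s) = s * d := by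
  rw [gaussianLaw, integral_map (by fun_prop) (by fun_prop)]
  simp_rw [norm_smul, mul_pow, Real.norm_eq_abs, sq_abs, Real.sq_sqrt hs]
  rw [integral_const_mul, integral_norm_sq_stdGaussian]

end Gaussian

/-! ### The noise of one round -/

section Noise

open Finset

variable {n m d b : ℕ} {sCor sInd : ℝ}

theorem isProbabilityMeasure_roundLaw (hbm : b ≤ m) (sCor sInd : ℝ) :
    IsProbabilityMeasure (roundLaw n m d b sCor sInd) := by
  have := isProbabilityMeasure_batchLaw hbm
  unfold roundLaw
  infer_instance

theorem measurePreserving_batch (hbm : b ≤ m) (i : Fin n) :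
    MeasurePreserving (fun ρ : Round n m d => ρ.1 i) (roundLaw n m d b sCor sInd)
      (batchLaw m b) := by
  have := isProbabilityMeasure_batchLaw hbm
  exact (measurePreserving_eval (fun _ : Fin n => batchLaw m b) i).comp measurePreserving_fst

theorem measurePreserving_shared (hbm : b ≤ m) (i j : Fin n) :
    MeasurePreserving (fun ρ : Round n m d => ρ.2.1 i j) (roundLaw n m d b sCor sInd)
      (gaussianLaw d sCor) := by
  have := isProbabilityMeasure_batchLaw hbm
  exact (measurePreserving_eval (fun _ : Fin n => gaussianLaw d sCor) j).comp
    ((measurePreserving_eval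
      (fun _ : Fin n => Measure.pi fun _ : Fin n => gaussianLaw d sCor) i).comp
      (measurePreserving_fst.comp measurePreserving_snd))

theorem measurePreserving_own (hbm : b ≤ m) (i : Fin n) :
    MeasurePreserving (fun ρ : Round n m d => ρ.2.2 i) (roundLaw n m d b sCor sInd)
      (gaussianLaw d sInd) := by
  have := isProbabilityMeasure_batchLaw hbm
  exact (measurePreserving_eval (fun _ : Fin n => gaussianLaw d sInd) i).comp
    (measurePreserving_snd.comp measurePreserving_snd)

/-- The independent noise of `i` for `i = j`, and the correlated noise between `i` and `j`
otherwise, so that the noise of `i` is a sum of `n` terms of the same kind. -/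
def pairNoise (i j : Fin n) (ρ : Round n m d) : E d :=
  if i = j then ρ.2.2 i else corNoise ρ i j

theorem noise_eq_sum_pairNoise (ρ : Round n m d) (i : Fin n) :
    noise ρ i = ∑ j, pairNoise i j ρ := by
  rw [← sum_erase_add _ _ (mem_univ i), noise]
  congr 1
  · exact sum_congr rfl fun j hj => by rw [pairNoise, if_neg (ne_of_mem_erase hj).symm]
  · rw [pairNoise, if_pos rfl]

theorem pairNoise_antisymm {i j : Fin n} (h : i ≠ j) (ρ : Round n m d) :
    pairNoise i j ρ = -pairNoise j i ρ := by
  rw [pairNoise, pairNoise, if_neg h, if_neg h.symm, corNoise, corNoise]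
  rcases lt_or_gt_of_ne h with h | h
  · rw [if_pos h, if_neg h.not_gt, neg_neg]
  · rw [if_neg h.not_gt, if_pos h]

theorem sum_sum_erase_pairNoise (S : Finset (Fin n)) (ρ : Round n m d) :
    ∑ i ∈ S, ∑ j ∈ S.erase i, pairNoise i j ρ = 0 := by
  have swap : ∑ i ∈ S, ∑ j ∈ S.erase i, pairNoise i j ρ
      = ∑ j ∈ S, ∑ i ∈ S.erase j, pairNoise i j ρ :=
    sum_comm' fun i j => by grind
  have : IsAddTorsionFree (E d) := .of_isTorsionFree ℝ (E d)
  rw [← self_eq_neg, ← sum_neg_distrib]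
  conv_lhs => rw [swap]
  refine sum_congr rfl fun i _ => ?_
  rw [← sum_neg_distrib]
  exact sum_congr rfl fun j hj => pairNoise_antisymm (ne_of_mem_erase hj) ρ

theorem sum_noise_eq (S : Finset (Fin n)) (ρ : Round n m d) :
    ∑ i ∈ S, noise ρ i = ∑ i ∈ S, ∑ j ∈ insert i Sᶜ, pairNoise i j ρ := by
  have split : ∀ i ∈ S, noise ρ i
      = ∑ j ∈ insert i Sᶜ, pairNoise i j ρ + ∑ j ∈ S.erase i, pairNoise i j ρ := fun i _ => by
    have hdisj : Disjoint (insert i Sᶜ) (S.erase i) := by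
      rw [disjoint_left]
      grind [mem_compl]
    rw [noise_eq_sum_pairNoise, ← sum_union hdisj]
    congr 1
    grind [mem_compl]
  rw [sum_congr rfl split, sum_add_distrib, sum_sum_erase_pairNoise, add_zero]

theorem measurePreserving_pairNoise (hbm : b ≤ m) (i j : Fin n) :
    MeasurePreserving (pairNoise i j) (roundLaw n m d b sCor sInd)
      (gaussianLaw d (if i = j then sInd else sCor)) := by
  unfold pairNoise corNoise
  split_ifs
  · exact measurePreserving_own hbm i
  · exact measurePreserving_shared hbm i j
  · exact measurePreserving_neg_gaussianLaw.comp (measurePreserving_shared hbm j i)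

theorem memLp_pairNoise (hbm : b ≤ m) (i j : Fin n) :
    MemLp (pairNoise i j) 2 (roundLaw n m d b sCor sInd) :=
  memLp_gaussianLaw.comp_measurePreserving (measurePreserving_pairNoise hbm i j)

theorem integral_pairNoise (hbm : b ≤ m) (i j : Fin n) :
    ∫ ρ, pairNoise i j ρ ∂(roundLaw n m d b sCor sInd) = 0 :=
  (integral_comp_measurePreserving (measurePreserving_pairNoise hbm i j)
    aestronglyMeasurable_id).trans integral_id_gaussianLaw

theorem integral_norm_sq_pairNoise (hbm : b ≤ m) (hCor : 0 ≤ sCor) (hInd : 0 ≤ sInd)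
    (i j : Fin n) :
    ∫ ρ, ‖pairNoise i j ρ‖ ^ 2 ∂(roundLaw n m d b sCor sInd)
      = (if i = j then sInd else sCor) * d :=
  (integral_comp_measurePreserving (measurePreserving_pairNoise hbm i j)
    (g := fun z => ‖z‖ ^ 2) (by fun_prop)).trans
    (integral_norm_sq_gaussianLaw (by split_ifs <;> assumption))

/-- Change of sign of the noise attached to the unordered pair `e`. It preserves `roundLaw`, which
makes the noises of different pairs orthogonal. -/
def flipPair (e : Sym2 (Fin n)) (ρ : Round n m d) : Round n m d :=
  (ρ.1, fun i j => if s(i, j) = e then -ρ.2.1 i j else ρ.2.1 i j,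
    fun i => if s(i, i) = e then -ρ.2.2 i else ρ.2.2 i)

theorem measurePreserving_flipPair (hbm : b ≤ m) (e : Sym2 (Fin n)) :
    MeasurePreserving (flipPair e) (roundLaw n m d b sCor sInd) (roundLaw n m d b sCor sInd) := by
  have := isProbabilityMeasure_batchLaw hbm
  have flip_gaussian (s : ℝ) (c : Prop) [Decidable c] : MeasurePreserving
      (fun z : E d => if c then -z else z) (gaussianLaw d s) (gaussianLaw d s) := by
    split_ifs
    exacts [measurePreserving_neg_gaussianLaw, .id _]
  exact (MeasurePreserving.id (Measure.pi fun _ : Fin n => batchLaw m b)).prod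
    ((measurePreserving_pi _ _ fun i => measurePreserving_pi _ _ fun j =>
      flip_gaussian sCor (s(i, j) = e)).prod
    (measurePreserving_pi _ _ fun i => flip_gaussian sInd (s(i, i) = e)))

theorem pairNoise_flipPair_self (i j : Fin n) (ρ : Round n m d) :
    pairNoise i j (flipPair s(i, j) ρ) = -pairNoise i j ρ := by
  unfold pairNoise corNoise flipPair
  split_ifs <;> simp_all

theorem pairNoise_flipPair_of_ne {i j : Fin n} {e : Sym2 (Fin n)} (h : s(i, j) ≠ e)
    (ρ : Round n m d) : pairNoise i j (flipPair e ρ) = pairNoise i j ρ := by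
  unfold pairNoise corNoise flipPair
  have h' : s(j, i) ≠ e := Sym2.eq_swap (a := i) ▸ h
  split_ifs <;> simp_all

theorem integral_inner_pairNoise (hbm : b ≤ m) {i j k l : Fin n} (h : s(k, l) ≠ s(i, j)) :
    ∫ ρ, inner ℝ (pairNoise i j ρ) (pairNoise k l ρ) ∂(roundLaw n m d b sCor sInd) = 0 :=
  integral_inner_eq_zero_of_comp_eq_neg (memLp_pairNoise hbm i j).aestronglyMeasurable
    (memLp_pairNoise hbm k l).aestronglyMeasurable (measurePreserving_flipPair hbm s(i, j))
    (pairNoise_flipPair_self i j) (pairNoise_flipPair_of_ne h)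

theorem memLp_noise (hbm : b ≤ m) (i : Fin n) :
    MemLp (fun ρ => noise ρ i) 2 (roundLaw n m d b sCor sInd) := by
  simp_rw [noise_eq_sum_pairNoise]
  exact memLp_finsetSum _ fun j _ => memLp_pairNoise hbm i j

theorem integral_noise (hbm : b ≤ m) (i : Fin n) :
    ∫ ρ, noise ρ i ∂(roundLaw n m d b sCor sInd) = 0 := by
  have := isProbabilityMeasure_roundLaw (n := n) (d := d) hbm sCor sInd
  simp_rw [noise_eq_sum_pairNoise]
  rw [integral_finsetSum _ fun j _ => (memLp_pairNoise hbm i j).integrable one_le_two]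
  exact sum_eq_zero fun j _ => integral_pairNoise hbm i j

theorem integral_norm_sum_noise_sq (hbm : b ≤ m) (hCor : 0 ≤ sCor) (hInd : 0 ≤ sInd)
    (S : Finset (Fin n)) :
    ∫ ρ, ‖∑ i ∈ S, noise ρ i‖ ^ 2 ∂(roundLaw n m d b sCor sInd)
      = S.card * (((n - S.card) * sCor + sInd) * d) := by
  have sum_sq (i : Fin n) (hi : i ∈ S) : ∑ j ∈ insert i Sᶜ, (if i = j then sInd else sCor) * (d : ℝ)
      = ((n - S.card) * sCor + sInd) * d := by
    have hiS : i ∉ Sᶜ := notMem_compl.2 hi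
    have hn : S.card ≤ n := S.card_le_univ.trans_eq (Fintype.card_fin n)
    rw [← sum_mul, sum_insert hiS, if_pos rfl,
      sum_congr rfl fun j hj => if_neg (ne_of_mem_of_not_mem hj hiS).symm, sum_const, card_compl,
      Fintype.card_fin, nsmul_eq_mul, Nat.cast_sub hn]
    ring
  have distinct : ∀ p ∈ S.sigma fun i => insert i Sᶜ, ∀ q ∈ S.sigma fun i => insert i Sᶜ, p ≠ q →
      s(q.1, q.2) ≠ s(p.1, p.2) := by
    rintro ⟨i, j⟩ hp ⟨k, l⟩ hq hne
    simp only [mem_sigma, mem_insert, mem_compl] at hp hq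
    simp only [ne_eq, Sym2.eq_iff]
    grind
  simp_rw [sum_noise_eq, sum_sigma']
  rw [integral_norm_sum_sq_of_orthogonal (fun p _ => memLp_pairNoise hbm p.1 p.2)
    fun p hp q hq hne => integral_inner_pairNoise hbm (distinct p hp q hq hne)]
  simp_rw [integral_norm_sq_pairNoise hbm hCor hInd]
  rw [sum_sigma, sum_congr rfl sum_sq, sum_const, nsmul_eq_mul]

end Noise

/-! ### Stochastic gradients -/

section StochasticGradient

open Finset

theorem gradient_mean {ι V : Type*} [NormedAddCommGroup V] [InnerProductSpace ℝ V]
    [CompleteSpace V] {s : Finset ι} {g : ι → V → ℝ} {θ : V}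
    (hg : ∀ i ∈ s, DifferentiableAt ℝ (g i) θ) :
    gradient (fun θ => mean s fun i => g i θ) θ = mean s fun i => gradient (g i) θ := by
  have h : HasFDerivAt (fun θ => mean s fun i => g i θ) (mean s fun i => fderiv ℝ (g i) θ) θ :=
    (HasFDerivAt.fun_sum fun i hi => (hg i hi).hasFDerivAt).const_smul (s.card : ℝ)⁻¹
  rw [gradient, h.fderiv, mean, map_smul, map_sum]
  rfl

variable {X : Type*} {n m d b : ℕ} {sCor sInd σ G : ℝ} {ℓ : E d → X → ℝ} {D : Fin n → Fin m → X}
  {H : Finset (Fin n)} {i : Fin n}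

theorem localLoss_eq_mean (ℓ : E d → X → ℝ) (D : Fin n → Fin m → X) (i : Fin n) :
    localLoss ℓ D i = fun θ => mean univ fun j => ℓ θ (D i j) := by
  ext θ
  rw [localLoss, mean, card_univ, Fintype.card_fin, smul_eq_mul]

theorem differentiable_localLoss (hd : ∀ j, Differentiable ℝ fun θ => ℓ θ (D i j)) :
    Differentiable ℝ (localLoss ℓ D i) :=
  (Differentiable.fun_sum fun j _ => hd j).const_mul _

theorem gradient_localLoss (hd : ∀ j, Differentiable ℝ fun θ => ℓ θ (D i j)) (θ : E d) :
    gradient (localLoss ℓ D i) θ = mean univ fun j => pointGrad ℓ (D i j) θ := by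
  rw [localLoss_eq_mean]
  exact gradient_mean fun j _ => hd j θ

variable (hd : ∀ i ∈ H, ∀ j, Differentiable ℝ fun θ => ℓ θ (D i j))

include hd

theorem differentiable_honestLoss : Differentiable ℝ (honestLoss ℓ D H) :=
  (Differentiable.fun_sum fun i hi => differentiable_localLoss (hd i hi)).const_mul _

theorem gradient_honestLoss (θ : E d) :
    gradient (honestLoss ℓ D H) θ = mean H fun i => gradient (localLoss ℓ D i) θ :=
  gradient_mean fun i hi => differentiable_localLoss (hd i hi) θ

theorem spread_gradient_le (hG : BoundedHeterogeneity ℓ D H G) (θ : E d) :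
    spread H (fun i => gradient (localLoss ℓ D i) θ) ≤ d * G ^ 2 := by
  have coordinate (k : Fin d) : (H.card : ℝ)⁻¹ * ∑ i ∈ H,
      (gradient (localLoss ℓ D i) θ - gradient (honestLoss ℓ D H) θ) k ^ 2 ≤ G ^ 2 := by
    simpa [EuclideanSpace.inner_single_left] using hG θ (EuclideanSpace.single k 1) (by simp)
  rw [spread, ← gradient_honestLoss hd, mean, smul_eq_mul]
  simp_rw [EuclideanSpace.real_norm_sq_eq]
  rw [sum_comm, mul_sum]
  refine (sum_le_card_nsmul univ _ _ fun k _ => coordinate k).trans_eq ?_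
  rw [card_univ, Fintype.card_fin, nsmul_eq_mul]

omit hd

/-- Deviation of the gradient of worker `i` on the mini-batch `S` from its full gradient. -/
def batchError (ℓ : E d → X → ℝ) (D : Fin n → Fin m → X) (θ : E d) (i : Fin n)
    (S : Finset (Fin m)) : E d :=
  batchGrad ℓ D i S θ - gradient (localLoss ℓ D i) θ

/-- Deviation of the noisy gradient that worker `i` computes at `θ` from its full gradient. -/
def gradError (ℓ : E d → X → ℝ) (D : Fin n → Fin m → X) (θ : E d) (i : Fin n)
    (ρ : Round n m d) : E d :=
  noisyGrad ℓ D ρ i θ - gradient (localLoss ℓ D i) θ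

theorem noisyGrad_eq (θ : E d) (i : Fin n) (ρ : Round n m d) :
    noisyGrad ℓ D ρ i θ = gradient (localLoss ℓ D i) θ + gradError ℓ D θ i ρ := by
  rw [gradError, add_sub_cancel]

theorem gradError_eq (θ : E d) (i : Fin n) (ρ : Round n m d) :
    gradError ℓ D θ i ρ = batchError ℓ D θ i (ρ.1 i) + noise ρ i :=
  add_sub_right_comm _ _ _

theorem memLp_batchError (hbm : b ≤ m) (θ : E d) (i : Fin n) :
    MemLp (fun ρ => batchError ℓ D θ i (ρ.1 i)) 2 (roundLaw n m d b sCor sInd) := by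
  have := isProbabilityMeasure_batchLaw hbm
  have h : MemLp (batchError ℓ D θ i) 2 (batchLaw m b) := .of_discrete
  exact h.comp_measurePreserving (measurePreserving_batch hbm i)

theorem integral_batchError (hb : 1 ≤ b) (hbm : b ≤ m)
    (hd : ∀ j, Differentiable ℝ fun θ => ℓ θ (D i j)) (θ : E d) :
    ∫ ρ, batchError ℓ D θ i (ρ.1 i) ∂(roundLaw n m d b sCor sInd) = 0 := by
  have := isProbabilityMeasure_batchLaw hbm
  calc ∫ ρ, batchError ℓ D θ i (ρ.1 i) ∂(roundLaw n m d b sCor sInd)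
      = ∫ S, batchError ℓ D θ i S ∂(batchLaw m b) :=
        integral_comp_measurePreserving (measurePreserving_batch hbm i) .of_discrete
    _ = ∫ S, mean S (fun j => pointGrad ℓ (D i j) θ) ∂(batchLaw m b)
          - gradient (localLoss ℓ D i) θ := by
        unfold batchError batchGrad
        rw [integral_sub .of_finite (integrable_const _), integral_const, probReal_univ, one_smul]
        rfl
    _ = 0 := by rw [integral_batchLaw_mean hb hbm, gradient_localLoss hd, sub_self]

theorem batchError_eq_mean {S : Finset (Fin m)} (hS : S.Nonempty) (θ : E d) (i : Fin n) :
    batchError ℓ D θ i S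
      = mean S fun j => pointGrad ℓ (D i j) θ - gradient (localLoss ℓ D i) θ := by
  rw [mean_sub_const hS]
  rfl

theorem integral_norm_batchError_sq_le (hb : 1 ≤ b) (hbm : b ≤ m) (hσ : BoundedVariance ℓ D H σ)
    (hi : i ∈ H) (θ : E d) :
    ∫ ρ, ‖batchError ℓ D θ i (ρ.1 i)‖ ^ 2 ∂(roundLaw n m d b sCor sInd) ≤ σ ^ 2 := by
  have := isProbabilityMeasure_batchLaw hbm
  calc ∫ ρ, ‖batchError ℓ D θ i (ρ.1 i)‖ ^ 2 ∂(roundLaw n m d b sCor sInd)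
      = ∫ S, ‖batchError ℓ D θ i S‖ ^ 2 ∂(batchLaw m b) :=
        integral_comp_measurePreserving (measurePreserving_batch hbm i)
          (g := fun S => ‖batchError ℓ D θ i S‖ ^ 2) .of_discrete
    _ ≤ ∫ S, mean S (fun j => ‖pointGrad ℓ (D i j) θ - gradient (localLoss ℓ D i) θ‖ ^ 2)
          ∂(batchLaw m b) := by
        refine integral_mono_ae .of_finite .of_finite ?_
        filter_upwards [ae_card_batchLaw] with S hS
        rw [batchError_eq_mean (card_pos.1 (hb.trans_eq hS.symm))]
        exact norm_mean_sq_le _ _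
    _ = mean univ fun j => ‖pointGrad ℓ (D i j) θ - gradient (localLoss ℓ D i) θ‖ ^ 2 :=
        integral_batchLaw_mean hb hbm _
    _ ≤ σ ^ 2 := by simpa only [mean, card_univ, Fintype.card_fin, smul_eq_mul] using hσ i hi θ

theorem memLp_gradError (hbm : b ≤ m) (θ : E d) (i : Fin n) :
    MemLp (gradError ℓ D θ i) 2 (roundLaw n m d b sCor sInd) :=
  ((memLp_batchError hbm θ i).add (memLp_noise hbm i)).ae_eq
    (.of_forall fun ρ => (gradError_eq θ i ρ).symm)

theorem integral_gradError (hb : 1 ≤ b) (hbm : b ≤ m)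
    (hd : ∀ j, Differentiable ℝ fun θ => ℓ θ (D i j)) (θ : E d) :
    ∫ ρ, gradError ℓ D θ i ρ ∂(roundLaw n m d b sCor sInd) = 0 := by
  have := isProbabilityMeasure_roundLaw (n := n) (d := d) hbm sCor sInd
  simp_rw [gradError_eq]
  rw [integral_add ((memLp_batchError hbm θ i).integrable one_le_two)
    ((memLp_noise hbm i).integrable one_le_two), integral_batchError hb hbm hd,
    integral_noise hbm, add_zero]

theorem integral_norm_noise_sq (hbm : b ≤ m) (hCor : 0 ≤ sCor) (hInd : 0 ≤ sInd) (i : Fin n) :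
    ∫ ρ, ‖noise ρ i‖ ^ 2 ∂(roundLaw n m d b sCor sInd) = ((n - 1) * sCor + sInd) * d := by
  simpa using integral_norm_sum_noise_sq (d := d) hbm hCor hInd {i}

theorem integral_norm_mean_noise_sq (hbm : b ≤ m) (hCor : 0 ≤ sCor) (hInd : 0 ≤ sInd)
    (S : Finset (Fin n)) :
    ∫ ρ, ‖mean S fun i => noise ρ i‖ ^ 2 ∂(roundLaw n m d b sCor sInd)
      = ((n - S.card) * sCor + sInd) * d / S.card := by
  simp_rw [mean, norm_smul, mul_pow]
  rw [integral_const_mul, integral_norm_sum_noise_sq hbm hCor hInd, norm_inv, Real.norm_natCast]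
  field_simp

theorem integral_norm_gradError_sq_le (hb : 1 ≤ b) (hbm : b ≤ m) (hCor : 0 ≤ sCor)
    (hInd : 0 ≤ sInd) (hσ : BoundedVariance ℓ D H σ) (hi : i ∈ H) (θ : E d) :
    ∫ ρ, ‖gradError ℓ D θ i ρ‖ ^ 2 ∂(roundLaw n m d b sCor sInd)
      ≤ 2 * σ ^ 2 + 2 * (((n - 1) * sCor + sInd) * d) := by
  simp_rw [gradError_eq]
  refine (integral_norm_add_sq_le (memLp_batchError hbm θ i) (memLp_noise hbm i)).trans ?_
  rw [integral_norm_noise_sq hbm hCor hInd]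
  gcongr
  exact integral_norm_batchError_sq_le hb hbm hσ hi θ

theorem integral_norm_mean_gradError_sq_le (hb : 1 ≤ b) (hbm : b ≤ m) (hCor : 0 ≤ sCor)
    (hInd : 0 ≤ sInd) (hσ : BoundedVariance ℓ D H σ) (θ : E d) :
    ∫ ρ, ‖mean H fun i => gradError ℓ D θ i ρ‖ ^ 2 ∂(roundLaw n m d b sCor sInd)
      ≤ 2 * σ ^ 2 + 2 * (((n - H.card) * sCor + sInd) * d / H.card) := by
  have hB : ∀ i ∈ H, MemLp (fun ρ : Round n m d => batchError ℓ D θ i (ρ.1 i)) 2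
    (roundLaw n m d b sCor sInd) := fun i _ => memLp_batchError hbm θ i
  have batch_bound : ∫ ρ, ‖mean H fun i => batchError ℓ D θ i (ρ.1 i)‖ ^ 2
      ∂(roundLaw n m d b sCor sInd) ≤ σ ^ 2 :=
    (integral_mono (integrable_norm_sq (memLp_mean hB))
      (integrable_mean fun i hi => integrable_norm_sq (hB i hi))
      fun ρ => norm_mean_sq_le _ _).trans
      (integral_mean_norm_sq_le hB (sq_nonneg σ) fun i hi =>
        integral_norm_batchError_sq_le hb hbm hσ hi θ)
  simp_rw [gradError_eq, mean_add]
  refine (integral_norm_add_sq_le (memLp_mean hB)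
    (memLp_mean fun i _ => memLp_noise hbm i)).trans ?_
  rw [integral_norm_mean_noise_sq hbm hCor hInd]
  gcongr

end StochasticGradient

/-! ### Resampling one coordinate of a product measure -/

section Resampling

variable {ι : Type*} [DecidableEq ι] {R : ι → Type*} [∀ i, MeasurableSpace (R i)]
  (Q : ∀ i, Measure (R i)) [∀ i, IsProbabilityMeasure (Q i)]

theorem measurePreserving_update_infinitePi (k : ι) :
    MeasurePreserving (fun q : (∀ i, R i) × R k => Function.update q.1 k q.2)
      ((Measure.infinitePi Q).prod (Q k)) (Measure.infinitePi Q) := by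
  refine ⟨measurable_update', Measure.eq_infinitePi _ fun s t ht => ?_⟩
  have preimage : (fun q : (∀ i, R i) × R k => Function.update q.1 k q.2) ⁻¹' (s : Set ι).pi t
      = ((s.erase k : Finset ι) : Set ι).pi t ×ˢ {x | k ∈ s → x ∈ t k} := by
    ext q
    rw [Finset.coe_erase]
    exact Set.update_mem_pi_iff
  rw [Measure.map_apply measurable_update' (.pi s.countable_toSet fun i _ => ht i), preimage,
    Measure.prod_prod, Measure.infinitePi_pi _ fun i _ => ht i]
  by_cases hk : k ∈ s
  · simpa [hk] using Finset.prod_erase_mul s (fun i => Q i (t i)) hk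
  · simp [hk]

variable {A : Type*} [MeasurableSpace A] (ν : Measure A) [IsProbabilityMeasure ν]

theorem measurePreserving_resample (k : ι) :
    MeasurePreserving (fun q : (A × (∀ i, R i)) × R k => (q.1.1, Function.update q.1.2 k q.2))
      ((ν.prod (Measure.infinitePi Q)).prod (Q k)) (ν.prod (Measure.infinitePi Q)) :=
  ((MeasurePreserving.id ν).prod (measurePreserving_update_infinitePi Q k)).comp
    (measurePreserving_prodAssoc ν (Measure.infinitePi Q) (Q k))

theorem integrable_and_integral_le_of_resample (k : ι) {Φ Ψ : A × (∀ i, R i) → ℝ}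
    (hΦ : Measurable Φ) (hΦ0 : ∀ s, 0 ≤ Φ s) (hΨ : Integrable Ψ (ν.prod (Measure.infinitePi Q)))
    (hint : ∀ s : A × (∀ i, R i),
      Integrable (fun ρ => Φ (s.1, Function.update s.2 k ρ)) (Q k))
    (hle : ∀ s : A × (∀ i, R i),
      ∫ ρ, Φ (s.1, Function.update s.2 k ρ) ∂(Q k) ≤ Ψ s) :
    Integrable Φ (ν.prod (Measure.infinitePi Q)) ∧
      ∫ s, Φ s ∂(ν.prod (Measure.infinitePi Q)) ≤ ∫ s, Ψ s ∂(ν.prod (Measure.infinitePi Q)) := by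
  set P := ν.prod (Measure.infinitePi Q)
  have hT := measurePreserving_resample Q ν k
  have hmeas := (hΦ.comp hT.measurable).aestronglyMeasurable (μ := P.prod (Q k))
  have hprod : Integrable
      (fun q : (A × (∀ i, R i)) × R k => Φ (q.1.1, Function.update q.1.2 k q.2))
      (P.prod (Q k)) := by
    refine (integrable_prod_iff hmeas).2 ⟨.of_forall hint, ?_⟩
    refine hΨ.mono' hmeas.norm.integral_prod_right' (.of_forall fun s => ?_)
    simp only [Function.comp_def, Real.norm_of_nonneg (hΦ0 _)]
    rw [Real.norm_of_nonneg (integral_nonneg fun ρ => hΦ0 _)]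
    exact hle s
  refine ⟨(hT.integrable_comp hΦ.aestronglyMeasurable).1 hprod, ?_⟩
  rw [← integral_comp_measurePreserving hT hΦ.aestronglyMeasurable, integral_prod _ hprod]
  exact integral_mono hprod.integral_prod_left hΨ hle

end Resampling

/-! ### Measurability of the run -/

section Measurability

variable {X : Type*} {n m d : ℕ} {ℓ : E d → X → ℝ} {D : Fin n → Fin m → X}
  {H : Finset (Fin n)}

theorem measurableSet_sort_eq (σ : Equiv.Perm (Fin n)) :
    MeasurableSet {x : Fin n → ℝ | σ = Tuple.sort x} := by
  simp only [Tuple.eq_sort_iff, Monotone]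
  measurability

theorem measurable_trimmedMean (f : ℕ) : Measurable (trimmedMean f : (Fin n → ℝ) → ℝ) := by
  have sum_over_sortings : (trimmedMean f : (Fin n → ℝ) → ℝ) = fun x =>
      ∑ σ : Equiv.Perm (Fin n), if σ = Tuple.sort x then ((n : ℝ) - 2 * f)⁻¹ *
        ∑ r ∈ Finset.univ.filter (fun r : Fin n => f ≤ (r : ℕ) ∧ (r : ℕ) + f < n), x (σ r)
      else 0 := by
    ext x
    rw [Finset.sum_ite_eq' Finset.univ, if_pos (Finset.mem_univ _)]
    rfl
  rw [sum_over_sortings]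
  exact Finset.measurable_fun_sum _ fun σ _ => .ite (measurableSet_sort_eq σ) (by fun_prop)
    measurable_const

theorem measurable_cwtm (f : ℕ) : Measurable (cwtm f : (Fin n → E d) → E d) :=
  (WithLp.measurable_toLp 2 _).comp <| measurable_pi_lambda _ fun k =>
    (measurable_trimmedMean f).comp (by fun_prop)

theorem measurable_gradient (F : E d → ℝ) : Measurable (gradient F) :=
  (InnerProductSpace.toDual ℝ (E d)).symm.continuous.measurable.comp (measurable_fderiv ℝ F)

theorem measurable_mean : Measurable (mean H : (Fin n → E d) → E d) := by
  unfold mean; fun_prop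

theorem measurable_spread : Measurable (spread H : (Fin n → E d) → ℝ) := by
  have := measurable_mean (d := d) (H := H)
  unfold spread mean; fun_prop

theorem measurable_batchGrad (i : Fin n) :
    Measurable fun q : Finset (Fin m) × E d => batchGrad ℓ D i q.1 q.2 := by
  refine measurable_from_prod_countable_right fun S => ?_
  have sum_grad : Measurable fun θ => ∑ j ∈ S, pointGrad ℓ (D i j) θ :=
    Finset.measurable_fun_sum S fun j _ => measurable_gradient _
  exact sum_grad.const_smul (S.card : ℝ)⁻¹

theorem measurable_noise (i : Fin n) : Measurable fun ρ : Round n m d => noise ρ i := by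
  have hcor (j : Fin n) : Measurable fun ρ : Round n m d => corNoise ρ i j := by
    unfold corNoise; split_ifs <;> fun_prop
  unfold noise; fun_prop

theorem measurable_noisyGrad (i : Fin n) :
    Measurable fun q : Round n m d × E d => noisyGrad ℓ D q.1 i q.2 :=
  ((measurable_batchGrad i).comp (by fun_prop : Measurable fun q : Round n m d × E d =>
    (q.1.1 i, q.2))).add ((measurable_noise i).comp measurable_fst)

variable {A : Type} [MeasurableSpace A]

/-- The model `θ_{t+1}`, which depends on the rounds up to `t` only. -/
def nextModel (ℓ : E d → X → ℝ) (D : Fin n → Fin m → X) (H : Finset (Fin n)) (p : Params n d)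
    (adv : Adversary n m d A) (a : A) (ω : ℕ → Round n m d) (t : ℕ) : E d :=
  (state ℓ D H p adv a ω t).1 - p.lr t • p.agg fun i =>
    if i ∈ H then (state ℓ D H p adv a ω t).2 i else adv.msg t (a, fun k => ω k) i

theorem state_succ (p : Params n d) (adv : Adversary n m d A) (a : A) (ω : ℕ → Round n m d)
    (t : ℕ) :
    state ℓ D H p adv a ω (t + 1) = (nextModel ℓ D H p adv a ω t, fun i =>
      p.mom t • (state ℓ D H p adv a ω t).2 i
        + (1 - p.mom t) • noisyGrad ℓ D (ω (t + 1)) i (nextModel ℓ D H p adv a ω t)) :=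
  rfl

section

variable {p : Params n d} {adv : Adversary n m d A} {a : A} {ω ω' : ℕ → Round n m d} {t : ℕ}

theorem nextModel_congr (h : ∀ k ≤ t, ω k = ω' k)
    (hs : state ℓ D H p adv a ω t = state ℓ D H p adv a ω' t) :
    nextModel ℓ D H p adv a ω t = nextModel ℓ D H p adv a ω' t := by
  have history : (fun k : Finset.Iic t => ω k) = fun k : Finset.Iic t => ω' k :=
    funext fun k => h k (Finset.mem_Iic.1 k.2)
  rw [nextModel, nextModel, hs, history]

theorem state_congr (h : ∀ k ≤ t, ω k = ω' k) :
    state ℓ D H p adv a ω t = state ℓ D H p adv a ω' t := by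
  induction t with
  | zero => rfl
  | succ t ih =>
    have h' : ∀ k ≤ t, ω k = ω' k := fun k hk => h k (hk.trans t.le_succ)
    rw [state_succ, state_succ, nextModel_congr h' (ih h'), ih h', h (t + 1) le_rfl]

end

theorem state_update (p : Params n d) (adv : Adversary n m d A) (a : A) (ω : ℕ → Round n m d)
    (t : ℕ) (ρ : Round n m d) :
    state ℓ D H p adv a (Function.update ω (t + 1) ρ) t = state ℓ D H p adv a ω t :=
  state_congr fun k hk => Function.update_of_ne (by lia) _ _

theorem nextModel_update (p : Params n d) (adv : Adversary n m d A) (a : A)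
    (ω : ℕ → Round n m d) (t : ℕ) (ρ : Round n m d) :
    nextModel ℓ D H p adv a (Function.update ω (t + 1) ρ) t = nextModel ℓ D H p adv a ω t :=
  nextModel_congr (fun k hk => Function.update_of_ne (by lia) _ _) (state_update p adv a ω t ρ)

variable {p : Params n d} (hp : Measurable p.agg) (adv : Adversary n m d A)

include hp

theorem measurable_nextModel {t : ℕ}
    (hs : Measurable fun s : A × (ℕ → Round n m d) => state ℓ D H p adv s.1 s.2 t) :
    Measurable fun s : A × (ℕ → Round n m d) => nextModel ℓ D H p adv s.1 s.2 t := by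
  have messages : Measurable fun s : A × (ℕ → Round n m d) => fun i =>
      if i ∈ H then (state ℓ D H p adv s.1 s.2 t).2 i else adv.msg t (s.1, fun k => s.2 k) i := by
    refine measurable_pi_lambda _ fun i => ?_
    split_ifs
    · exact (measurable_pi_apply i).comp hs.snd
    · exact (measurable_pi_apply i).comp ((adv.measurable_msg t).comp (by fun_prop))
  exact hs.fst.sub ((hp.comp messages).const_smul (p.lr t))

theorem measurable_state (t : ℕ) :
    Measurable fun s : A × (ℕ → Round n m d) => state ℓ D H p adv s.1 s.2 t := by
  induction t with
  | zero => exact measurable_const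
  | succ t ih =>
    have hN := measurable_nextModel hp adv ih
    simp_rw [state_succ]
    refine hN.prodMk (measurable_pi_lambda _ fun i => ?_)
    have momentum : Measurable fun s : A × (ℕ → Round n m d) =>
        (state ℓ D H p adv s.1 s.2 t).2 i := (measurable_pi_apply i).comp ih.snd
    have round : Measurable fun s : A × (ℕ → Round n m d) =>
        (s.2 (t + 1), nextModel ℓ D H p adv s.1 s.2 t) := .prodMk (by fun_prop) hN
    exact (momentum.const_smul (p.mom t)).add
      (((measurable_noisyGrad (ℓ := ℓ) (D := D) i).comp round).const_smul (1 - p.mom t))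

end Measurability

/-! ### Recursions along the run -/

section Recursion

variable {X : Type*} {n m d b : ℕ} {sCor sInd : ℝ} {ℓ : E d → X → ℝ} {D : Fin n → Fin m → X}
  {H : Finset (Fin n)}

theorem momentum_step_eq (θ : E d) (M : Fin n → E d) (β : ℝ) (ρ : Round n m d) (i : Fin n) :
    β • M i + (1 - β) • noisyGrad ℓ D ρ i θ
      = (β • M i + (1 - β) • gradient (localLoss ℓ D i) θ) + (1 - β) • gradError ℓ D θ i ρ := by
  rw [noisyGrad_eq, smul_add, add_assoc]

theorem integrable_spread_momentum_step (hbm : b ≤ m) (θ : E d) (M : Fin n → E d) (β : ℝ) :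
    Integrable (fun ρ => spread H fun i => β • M i + (1 - β) • noisyGrad ℓ D ρ i θ)
      (roundLaw n m d b sCor sInd) := by
  have := isProbabilityMeasure_roundLaw (n := n) (d := d) hbm sCor sInd
  simp only [momentum_step_eq]
  exact integrable_spread fun i _ => memLp_const_add_smul (memLp_gradError hbm θ i) _ _

theorem mean_momentum_step_sub_gradient_eq
    (hd : ∀ i ∈ H, ∀ j, Differentiable ℝ fun θ => ℓ θ (D i j))
    (θ : E d) (M : Fin n → E d) (β : ℝ) (ρ : Round n m d) :
    (mean H fun i => β • M i + (1 - β) • noisyGrad ℓ D ρ i θ) - gradient (honestLoss ℓ D H) θ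
      = β • (mean H M - gradient (honestLoss ℓ D H) θ)
        + (1 - β) • mean H fun i => gradError ℓ D θ i ρ := by
  simp only [momentum_step_eq, mean_add, mean_smul, gradient_honestLoss hd]
  module

theorem integrable_lyapunov_momentum_step (hbm : b ≤ m)
    (hd : ∀ i ∈ H, ∀ j, Differentiable ℝ fun θ => ℓ θ (D i j))
    (L : ℝ) (θ : E d) (M : Fin n → E d) (β : ℝ) :
    Integrable (fun ρ => lyapunov L (honestLoss ℓ D H) θ
      (mean H fun i => β • M i + (1 - β) • noisyGrad ℓ D ρ i θ))
      (roundLaw n m d b sCor sInd) := by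
  have := isProbabilityMeasure_roundLaw (n := n) (d := d) hbm sCor sInd
  simp only [lyapunov, mean_momentum_step_sub_gradient_eq hd]
  exact (integrable_const _).add <| .const_mul (integrable_norm_sq <|
    memLp_const_add_smul (memLp_mean fun i _ => memLp_gradError hbm θ i) _ _) _

variable (hb : 1 ≤ b) (hbm : b ≤ m) (hd : ∀ i ∈ H, ∀ j, Differentiable ℝ fun θ => ℓ θ (D i j))

include hb hbm hd

theorem integral_spread_momentum_step_le {θ : E d} {B V : ℝ}
    (hB : spread H (fun i => gradient (localLoss ℓ D i) θ) ≤ B)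
    (hV : ∀ i ∈ H, ∫ ρ, ‖gradError ℓ D θ i ρ‖ ^ 2 ∂(roundLaw n m d b sCor sInd) ≤ V)
    (hV0 : 0 ≤ V) (M : Fin n → E d) {β : ℝ} (hβ : 0 ≤ β) (hβ1 : β ≤ 1) :
    ∫ ρ, spread H (fun i => β • M i + (1 - β) • noisyGrad ℓ D ρ i θ)
        ∂(roundLaw n m d b sCor sInd)
      ≤ β * spread H M + ((1 - β) * B + (1 - β) ^ 2 * V) := by
  have := isProbabilityMeasure_roundLaw (n := n) (d := d) hbm sCor sInd
  have hE : ∀ i ∈ H, MemLp (gradError ℓ D θ i) 2 (roundLaw n m d b sCor sInd) :=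
    fun i _ => memLp_gradError hbm θ i
  have bias := spread_smul_add_smul_le hβ hβ1 H M fun i => gradient (localLoss ℓ D i) θ
  have variance : ∫ ρ, spread H (fun i => gradError ℓ D θ i ρ) ∂(roundLaw n m d b sCor sInd) ≤ V :=
    (integral_mono (integrable_spread hE) (integrable_mean fun i hi => integrable_norm_sq (hE i hi))
      fun ρ => spread_le_mean_norm_sq _ _).trans (integral_mean_norm_sq_le hE hV0 hV)
  simp only [momentum_step_eq]
  rw [integral_spread_const_add_smul hE fun i hi => integral_gradError hb hbm (hd i hi) θ,
    ← add_assoc]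
  gcongr
  exact bias.trans (by gcongr)

theorem integral_lyapunov_momentum_step (L : ℝ) (θ : E d) (M : Fin n → E d) (β : ℝ) :
    ∫ ρ, lyapunov L (honestLoss ℓ D H) θ
        (mean H fun i => β • M i + (1 - β) • noisyGrad ℓ D ρ i θ) ∂(roundLaw n m d b sCor sInd)
      = honestLoss ℓ D H θ - (⨅ θ, honestLoss ℓ D H θ)
        + L⁻¹ * (β ^ 2 * ‖mean H M - gradient (honestLoss ℓ D H) θ‖ ^ 2 + (1 - β) ^ 2 *
          ∫ ρ, ‖mean H fun i => gradError ℓ D θ i ρ‖ ^ 2 ∂(roundLaw n m d b sCor sInd)) := by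
  have := isProbabilityMeasure_roundLaw (n := n) (d := d) hbm sCor sInd
  have hE : ∀ i ∈ H, MemLp (gradError ℓ D θ i) 2 (roundLaw n m d b sCor sInd) :=
    fun i _ => memLp_gradError hbm θ i
  have centered : ∫ ρ, (mean H fun i => gradError ℓ D θ i ρ) ∂(roundLaw n m d b sCor sInd) = 0 :=
    integral_mean_eq_zero (fun i hi => (hE i hi).integrable one_le_two)
      fun i hi => integral_gradError hb hbm (hd i hi) θ
  have hmean := memLp_mean hE
  simp only [lyapunov, mean_momentum_step_sub_gradient_eq hd]
  rw [integral_add (integrable_const _)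
      ((integrable_norm_sq (memLp_const_add_smul hmean _ _)).const_mul _),
    integral_const, probReal_univ, one_smul, integral_const_mul,
    integral_norm_const_add_smul_sq hmean centered, norm_smul, mul_pow, Real.norm_eq_abs, sq_abs]

theorem integral_lyapunov_momentum_step_le {L μ γ κ s W : ℝ} {θ R : E d} {M : Fin n → E d}
    (hs : IsSmooth L (honestLoss ℓ D H)) (hc : IsStronglyConvex μ (honestLoss ℓ D H))
    (hL : 0 < L) (hμ : 0 < μ) (hμL : μ ≤ L) (hγ : 0 < γ) (hγL : 24 * L * γ ≤ 1)
    (hR : ‖R - mean H M‖ ^ 2 ≤ κ * s)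
    (hW : ∫ ρ, ‖mean H fun i => gradError ℓ D (θ - γ • R) i ρ‖ ^ 2
      ∂(roundLaw n m d b sCor sInd) ≤ W) :
    ∫ ρ, lyapunov L (honestLoss ℓ D H) (θ - γ • R)
        (mean H fun i => (1 - 24 * L * γ) • M i
          + (1 - (1 - 24 * L * γ)) • noisyGrad ℓ D ρ i (θ - γ • R))
        ∂(roundLaw n m d b sCor sInd)
      ≤ (1 - μ * γ) * lyapunov L (honestLoss ℓ D H) θ (mean H M) + γ * (κ * s)
        + L⁻¹ * ((24 * L * γ) ^ 2 * W) := by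
  have descent := (hs.lyapunov_step_le hc hL hμ hμL hγ hγL θ (mean H M) R).trans
    (add_le_add_right (mul_le_mul_of_nonneg_left hR hγ.le) _)
  rw [integral_lyapunov_momentum_step hb hbm hd, mul_add, ← add_assoc, sub_sub_cancel]
  exact add_le_add descent (by gcongr)

end Recursion

section Run

variable {X : Type*} {n m d : ℕ} {A : Type} [MeasurableSpace A]

/-- Spread of the honest momentums after `t` steps of the run. -/
def momentumSpread (ℓ : E d → X → ℝ) (D : Fin n → Fin m → X) (H : Finset (Fin n))
    (p : Params n d) (adv : Adversary n m d A) (t : ℕ) (s : A × (ℕ → Round n m d)) : ℝ :=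
  spread H (state ℓ D H p adv s.1 s.2 t).2

/-- Value of the Lyapunov function of the honest loss after `t` steps of the run, where the mean of
the honest momentums estimates the gradient. -/
def runLyapunov (L : ℝ) (ℓ : E d → X → ℝ) (D : Fin n → Fin m → X) (H : Finset (Fin n))
    (p : Params n d) (adv : Adversary n m d A) (t : ℕ) (s : A × (ℕ → Round n m d)) : ℝ :=
  lyapunov L (honestLoss ℓ D H) (state ℓ D H p adv s.1 s.2 t).1
    (mean H (state ℓ D H p adv s.1 s.2 t).2)

variable {ℓ : E d → X → ℝ} {D : Fin n → Fin m → X} {H : Finset (Fin n)} {p : Params n d}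

theorem measurable_momentumSpread (hp : Measurable p.agg) (adv : Adversary n m d A) (t : ℕ) :
    Measurable (momentumSpread ℓ D H p adv t) :=
  measurable_spread.comp (measurable_state hp adv t).snd

theorem measurable_runLyapunov (hd : ∀ i ∈ H, ∀ j, Differentiable ℝ fun θ => ℓ θ (D i j))
    (hp : Measurable p.agg) (L : ℝ) (adv : Adversary n m d A) (t : ℕ) :
    Measurable (runLyapunov L ℓ D H p adv t) := by
  have hF : Measurable (honestLoss ℓ D H) := (differentiable_honestLoss hd).continuous.measurable
  have hgrad := measurable_gradient (honestLoss ℓ D H)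
  have hstate := measurable_state (ℓ := ℓ) (D := D) (H := H) hp adv t
  have := hstate.fst
  have hmean : Measurable fun s : A × (ℕ → Round n m d) =>
      mean H (state ℓ D H p adv s.1 s.2 t).2 := measurable_mean.comp hstate.snd
  unfold runLyapunov lyapunov
  fun_prop

theorem momentumSpread_nonneg (adv : Adversary n m d A) (t : ℕ) (s : A × (ℕ → Round n m d)) :
    0 ≤ momentumSpread ℓ D H p adv t s :=
  spread_nonneg _ _

theorem runLyapunov_nonneg {L μ : ℝ} (hL : 0 ≤ L) (hμ : 0 < μ)
    (hc : IsStronglyConvex μ (honestLoss ℓ D H)) (adv : Adversary n m d A) (t : ℕ)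
    (s : A × (ℕ → Round n m d)) : 0 ≤ runLyapunov L ℓ D H p adv t s :=
  hc.lyapunov_nonneg hμ hL _ _

theorem isProbabilityMeasure_runLaw (hbm : p.batchSize ≤ m) (ν : Measure A)
    [IsProbabilityMeasure ν] : IsProbabilityMeasure (runLaw m p ν) := by
  have := isProbabilityMeasure_roundLaw (n := n) (d := d) hbm p.varCor p.varInd
  unfold runLaw
  infer_instance

variable (hb : 1 ≤ p.batchSize) (hbm : p.batchSize ≤ m)
  (hd : ∀ i ∈ H, ∀ j, Differentiable ℝ fun θ => ℓ θ (D i j)) (hp : Measurable p.agg)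
  {adv : Adversary n m d A} {ν : Measure A} [IsProbabilityMeasure ν] {t : ℕ}

include hb hbm hd hp

theorem integrable_momentumSpread_succ_and_integral_le {B V : ℝ}
    (hB : ∀ θ, spread H (fun i => gradient (localLoss ℓ D i) θ) ≤ B)
    (hV : ∀ θ, ∀ i ∈ H, ∫ ρ, ‖gradError ℓ D θ i ρ‖ ^ 2
      ∂(roundLaw n m d p.batchSize p.varCor p.varInd) ≤ V) (hV0 : 0 ≤ V)
    (hβ : 0 ≤ p.mom t) (hβ1 : p.mom t ≤ 1)
    (hint : Integrable (momentumSpread ℓ D H p adv t) (runLaw m p ν)) :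
    Integrable (momentumSpread ℓ D H p adv (t + 1)) (runLaw m p ν) ∧
      ∫ s, momentumSpread ℓ D H p adv (t + 1) s ∂(runLaw m p ν)
        ≤ p.mom t * ∫ s, momentumSpread ℓ D H p adv t s ∂(runLaw m p ν)
          + ((1 - p.mom t) * B + (1 - p.mom t) ^ 2 * V) := by
  have := isProbabilityMeasure_roundLaw (n := n) (d := d) hbm p.varCor p.varInd
  have := isProbabilityMeasure_runLaw hbm ν
  have affine := (hint.const_mul (p.mom t)).add
    (integrable_const ((1 - p.mom t) * B + (1 - p.mom t) ^ 2 * V))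
  have step := integrable_and_integral_le_of_resample _ ν (t + 1)
    (measurable_momentumSpread (ℓ := ℓ) (D := D) (H := H) hp adv (t + 1))
    (momentumSpread_nonneg adv (t + 1)) affine (fun s => ?_) (fun s => ?_)
  · rwa [← runLaw, integral_add' (hint.const_mul _) (integrable_const _), integral_const_mul,
      integral_const, probReal_univ, one_smul] at step
  · simp only [momentumSpread, state_succ, state_update, nextModel_update, Function.update_self]
    exact integrable_spread_momentum_step hbm _ _ _
  · simp only [momentumSpread, state_succ, state_update, nextModel_update, Function.update_self]
    exact integral_spread_momentum_step_le hb hbm hd (hB _) (hV _) hV0 _ hβ hβ1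

theorem integrable_runLyapunov_succ_and_integral_le {f : ℕ} {L μ κ W : ℝ} (hHc : H.card = n - f)
    (hrob : IsRobustAveraging f κ p.agg)
    (hW : ∀ θ, ∫ ρ, ‖mean H fun i => gradError ℓ D θ i ρ‖ ^ 2
      ∂(roundLaw n m d p.batchSize p.varCor p.varInd) ≤ W)
    (hs : IsSmooth L (honestLoss ℓ D H)) (hc : IsStronglyConvex μ (honestLoss ℓ D H))
    (hL : 0 < L) (hμ : 0 < μ) (hμL : μ ≤ L) (hmom : p.mom t = 1 - 24 * L * p.lr t)
    (hγ : 0 < p.lr t) (hγL : 24 * L * p.lr t ≤ 1)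
    (hspread : Integrable (momentumSpread ℓ D H p adv t) (runLaw m p ν))
    (hint : Integrable (runLyapunov L ℓ D H p adv t) (runLaw m p ν)) :
    Integrable (runLyapunov L ℓ D H p adv (t + 1)) (runLaw m p ν) ∧
      ∫ s, runLyapunov L ℓ D H p adv (t + 1) s ∂(runLaw m p ν)
        ≤ (1 - μ * p.lr t) * ∫ s, runLyapunov L ℓ D H p adv t s ∂(runLaw m p ν)
          + p.lr t * (κ * ∫ s, momentumSpread ℓ D H p adv t s ∂(runLaw m p ν))
          + L⁻¹ * ((24 * L * p.lr t) ^ 2 * W) := by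
  have := isProbabilityMeasure_roundLaw (n := n) (d := d) hbm p.varCor p.varInd
  have := isProbabilityMeasure_runLaw hbm ν
  have hspread' := (hspread.const_mul κ).const_mul (p.lr t)
  have affine := ((hint.const_mul (1 - μ * p.lr t)).add hspread').add
    (integrable_const (L⁻¹ * ((24 * L * p.lr t) ^ 2 * W)))
  have step := integrable_and_integral_le_of_resample _ ν (t + 1)
    (measurable_runLyapunov hd hp L adv (t + 1))
    (runLyapunov_nonneg hL.le hμ hc adv (t + 1)) affine (fun s => ?_) (fun s => ?_)
  · rwa [← runLaw, integral_add' ((hint.const_mul _).add hspread') (integrable_const _),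
      integral_add' (hint.const_mul _) hspread', integral_const_mul, integral_const_mul,
      integral_const_mul, integral_const, probReal_univ, one_smul] at step
  · simp only [runLyapunov, state_succ, state_update, nextModel_update, Function.update_self]
    exact integrable_lyapunov_momentum_step hbm hd _ _ _ _
  · simp only [runLyapunov, state_succ, state_update, nextModel_update, Function.update_self, hmom]
    refine integral_lyapunov_momentum_step_le hb hbm hd hs hc hL hμ hμL hγ hγL ?_ (hW _)
    have robust := hrob H hHc fun i =>
      if i ∈ H then (state ℓ D H p adv s.1 s.2 t).2 i else adv.msg t (s.1, fun k => s.2 k) i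
    rwa [mean_congr fun i hi => if_pos hi, spread_congr fun i hi => if_pos hi] at robust

end Run

/-! ### Solving the recursions -/

section Convergence

theorem div_sub_div_sq_le_div_add_one {a u : ℝ} (ha : 0 ≤ a) (hu : 0 < u) :
    a / u - a / u ^ 2 ≤ a / (u + 1) := by
  have gap : a / (u + 1) - (a / u - a / u ^ 2) = a / (u ^ 2 * (u + 1)) := by field_simp; ring
  exact sub_nonneg.1 (gap ▸ by positivity)

theorem le_add_div_of_recursion {Z : ℕ → ℝ} {α q a b c : ℝ} (hq : 0 < q) (hαq : α ≤ q)
    (ha : 0 ≤ a) (hc : c ≤ (α - 1) * a) (h0 : Z 0 ≤ b + a / q)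
    (hZ : ∀ t : ℕ, Z (t + 1) ≤ (1 - α / (t + q)) * Z t + α / (t + q) * b + c / (t + q) ^ 2)
    (t : ℕ) : Z t ≤ b + a / (t + q) := by
  induction t with
  | zero => simpa using h0
  | succ t ih =>
    set u : ℝ := t + q with hu
    have hu0 : 0 < u := by positivity
    have contraction : 0 ≤ 1 - α / u :=
      sub_nonneg.2 ((div_le_one hu0).2 (hαq.trans (le_add_of_nonneg_left t.cast_nonneg)))
    calc Z (t + 1) ≤ (1 - α / u) * Z t + α / u * b + c / u ^ 2 := hZ t
      _ ≤ (1 - α / u) * (b + a / u) + α / u * b + (α - 1) * a / u ^ 2 := by gcongr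
      _ = b + (a / u - a / u ^ 2) := by field_simp; ring
      _ ≤ b + a / (u + 1) := by gcongr; exact div_sub_div_sq_le_div_add_one ha hu0
      _ = b + a / ((t + 1 : ℕ) + q) := by rw [hu]; push_cast; ring

theorem stepSize_pos {L μ : ℝ} (hL : 0 < L) (hμ : 0 < μ) (t : ℕ) : 0 < stepSize L μ t := by
  unfold stepSize; positivity

theorem mul_stepSize {L μ : ℝ} (hμ : 0 < μ) (t : ℕ) :
    μ * stepSize L μ t = 10 / (t + 240 * (L / μ)) := by
  rw [stepSize, ← mul_div_assoc, mul_div_mul_left _ _ hμ.ne']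

theorem smoothness_mul_stepSize {L μ : ℝ} (hμ : 0 < μ) (t : ℕ) :
    24 * L * stepSize L μ t = 240 * (L / μ) / (t + 240 * (L / μ)) := by
  calc 24 * L * stepSize L μ t = 24 * (L / μ) * (μ * stepSize L μ t) := by field_simp
    _ = 240 * (L / μ) / (t + 240 * (L / μ)) := by rw [mul_stepSize hμ]; ring

theorem stepSize_mul_add_eq {L μ : ℝ} (hL : 0 < L) (hμ : 0 < μ) (κ B V W : ℝ) (t : ℕ) :
    stepSize L μ t * (κ * (B + 2 * (240 * (L / μ)) * V / (t + 240 * (L / μ))))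
        + L⁻¹ * ((24 * L * stepSize L μ t) ^ 2 * W)
      = 10 / (t + 240 * (L / μ)) * (κ * B / μ)
        + L / μ ^ 2 * (4800 * κ * V + 57600 * W) / (t + 240 * (L / μ)) ^ 2 := by
  have hu : (t : ℝ) + 240 * (L / μ) ≠ 0 := by positivity
  rw [smoothness_mul_stepSize hμ, stepSize]
  generalize (t : ℝ) + 240 * (L / μ) = u at hu ⊢
  field_simp
  ring

variable {X : Type*} {n m d : ℕ} {ℓ : E d → X → ℝ} {D : Fin n → Fin m → X}
  {H : Finset (Fin n)} {p : Params n d} {A : Type} [MeasurableSpace A] {B V : ℝ}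
  (hb : 1 ≤ p.batchSize) (hbm : p.batchSize ≤ m)
  (hd : ∀ i ∈ H, ∀ j, Differentiable ℝ fun θ => ℓ θ (D i j)) (hp : Measurable p.agg)
  (hB : ∀ θ, spread H (fun i => gradient (localLoss ℓ D i) θ) ≤ B)
  (hV : ∀ θ, ∀ i ∈ H, ∫ ρ, ‖gradError ℓ D θ i ρ‖ ^ 2
    ∂(roundLaw n m d p.batchSize p.varCor p.varInd) ≤ V) (hV0 : 0 ≤ V)

include hb hbm hd hp hB hV hV0

theorem integrable_momentumSpread_and_integral_le {q : ℝ} (hq : 2 ≤ q)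
    (hmom : ∀ t : ℕ, p.mom t = 1 - q / (t + q)) (adv : Adversary n m d A) (ν : Measure A)
    [IsProbabilityMeasure ν] (t : ℕ) :
    Integrable (momentumSpread ℓ D H p adv t) (runLaw m p ν) ∧
      ∫ s, momentumSpread ℓ D H p adv t s ∂(runLaw m p ν) ≤ B + 2 * q * V / (t + q) := by
  have hB0 : 0 ≤ B := (spread_nonneg _ _).trans (hB 0)
  have hβ (t : ℕ) : 0 ≤ p.mom t := by
    rw [hmom, sub_nonneg, div_le_one (by positivity)]
    exact le_add_of_nonneg_left t.cast_nonneg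
  have hβ1 (t : ℕ) : p.mom t ≤ 1 := by
    rw [hmom]
    exact sub_le_self _ (by positivity)
  have initial : momentumSpread ℓ D H p adv 0 = 0 := funext fun _ => spread_zero H
  have step (t : ℕ) := integrable_momentumSpread_succ_and_integral_le (adv := adv) (ν := ν)
    hb hbm hd hp hB hV hV0 (hβ t) (hβ1 t)
  have hint (t : ℕ) : Integrable (momentumSpread ℓ D H p adv t) (runLaw m p ν) := by
    induction t with
    | zero => exact initial ▸ integrable_zero _ _ _
    | succ t ih => exact (step t ih).1
  refine ⟨hint t, le_add_div_of_recursion (α := q) (c := q ^ 2 * V)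
    (Z := fun t => ∫ s, momentumSpread ℓ D H p adv t s ∂(runLaw m p ν))
    (by positivity) le_rfl (by positivity) ?_ ?_ (fun t => ?_) t⟩
  · nlinarith [mul_nonneg (mul_nonneg (zero_le_two.trans hq) hV0) (sub_nonneg.2 hq)]
  · simp only [initial, Pi.zero_apply, integral_zero]
    positivity
  · refine (step t (hint t)).2.trans ?_
    simp only [hmom, sub_sub_cancel, div_pow]
    exact le_of_eq (by ring)

theorem integrable_runLyapunov_and_integral_le {f : ℕ} {L μ κ W : ℝ} (hHc : H.card = n - f)
    (hκ : 0 ≤ κ) (hrob : IsRobustAveraging f κ p.agg)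
    (hW : ∀ θ, ∫ ρ, ‖mean H fun i => gradError ℓ D θ i ρ‖ ^ 2
      ∂(roundLaw n m d p.batchSize p.varCor p.varInd) ≤ W)
    (hs : IsSmooth L (honestLoss ℓ D H)) (hc : IsStronglyConvex μ (honestLoss ℓ D H))
    (hμ : 0 < μ) (hμL : μ ≤ L) (hlr : p.lr = stepSize L μ)
    (hmom : ∀ t, p.mom t = 1 - 24 * L * p.lr t) (adv : Adversary n m d A) (ν : Measure A)
    [IsProbabilityMeasure ν] (t : ℕ) :
    Integrable (runLyapunov L ℓ D H p adv t) (runLaw m p ν) ∧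
      ∫ s, runLyapunov L ℓ D H p adv t s ∂(runLaw m p ν)
        ≤ κ * B / μ + (240 * (L / μ) * lyapunov L (honestLoss ℓ D H) p.init 0
          + L / μ ^ 2 * (4800 * κ * V + 57600 * W)) / (t + 240 * (L / μ)) := by
  have hL : 0 < L := hμ.trans_le hμL
  have hB0 : 0 ≤ B := (spread_nonneg _ _).trans (hB 0)
  have hW0 : 0 ≤ W := (integral_nonneg fun _ => by positivity).trans (hW 0)
  have hΛ := hc.lyapunov_nonneg hμ hL.le p.init 0
  have hq : 240 ≤ 240 * (L / μ) := le_mul_of_one_le_right (by simp) ((one_le_div hμ).2 hμL)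
  have := isProbabilityMeasure_runLaw (n := n) (d := d) hbm ν
  have spread_bound := integrable_momentumSpread_and_integral_le hb hbm hd hp hB hV hV0
    (q := 240 * (L / μ)) (by linarith)
    (fun t => by rw [hmom, hlr, smoothness_mul_stepSize hμ]) adv ν
  have initial : runLyapunov L ℓ D H p adv 0
      = fun _ => lyapunov L (honestLoss ℓ D H) p.init 0 :=
    funext fun s => by simp [runLyapunov, state, mean]
  have step (t : ℕ) := integrable_runLyapunov_succ_and_integral_le (adv := adv) (ν := ν)
    hb hbm hd hp hHc hrob hW hs hc hL hμ hμL (hmom t) (hlr ▸ stepSize_pos hL hμ t)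
    (by
      rw [hlr, smoothness_mul_stepSize hμ, div_le_one (by positivity)]
      exact le_add_of_nonneg_left t.cast_nonneg) (spread_bound t).1
  have hint (t : ℕ) : Integrable (runLyapunov L ℓ D H p adv t) (runLaw m p ν) := by
    induction t with
    | zero => exact initial ▸ integrable_const _
    | succ t ih => exact (step t ih).1
  refine ⟨hint t, le_add_div_of_recursion (α := 10)
    (c := L / μ ^ 2 * (4800 * κ * V + 57600 * W))
    (Z := fun t => ∫ s, runLyapunov L ℓ D H p adv t s ∂(runLaw m p ν))
    (by positivity) (by linarith) (by positivity) ?_ ?_ (fun t => ?_) t⟩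
  · have : 0 ≤ 240 * (L / μ) * lyapunov L (honestLoss ℓ D H) p.init 0 := by positivity
    have : 0 ≤ L / μ ^ 2 * (4800 * κ * V + 57600 * W) := by positivity
    linarith
  · simp only [initial, integral_const, probReal_univ, one_smul]
    rw [add_div, mul_div_cancel_left₀ _ (by positivity)]
    exact (le_add_of_nonneg_right (by positivity)).trans (le_add_of_nonneg_left (by positivity))
  · refine (step t (hint t)).2.trans ?_
    rw [hlr, mul_stepSize hμ, add_assoc, add_assoc, ← stepSize_mul_add_eq hL hμ]
    have := (stepSize_pos hL hμ t).le
    gcongr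
    exact (spread_bound t).2

theorem isRobust_of_isRobustAveraging {f : ℕ} {L μ κ W : ℝ} (hHc : H.card = n - f)
    (hκ : 0 ≤ κ) (hrob : IsRobustAveraging f κ p.agg)
    (hW : ∀ θ, ∫ ρ, ‖mean H fun i => gradError ℓ D θ i ρ‖ ^ 2
      ∂(roundLaw n m d p.batchSize p.varCor p.varInd) ≤ W)
    (hs : IsSmooth L (honestLoss ℓ D H)) (hc : IsStronglyConvex μ (honestLoss ℓ D H))
    (hμ : 0 < μ) (hμL : μ ≤ L) (hlr : p.lr = stepSize L μ)
    (hmom : ∀ t, p.mom t = 1 - 24 * L * p.lr t) (T : ℕ) :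
    IsRobust ℓ D H p T (κ * B / μ + (240 * (L / μ) * lyapunov L (honestLoss ℓ D H) p.init 0
      + L / μ ^ 2 * (4800 * κ * V + 57600 * W)) / (T + 240 * (L / μ))) := by
  intro A _ ν _ adv
  obtain ⟨hint, hle⟩ := integrable_runLyapunov_and_integral_le hb hbm hd hp hB hV hV0 hHc hκ hrob
    hW hs hc hμ hμL hlr hmom adv ν T
  have gap_le (s : A × (ℕ → Round n m d)) :
      honestLoss ℓ D H (state ℓ D H p adv s.1 s.2 T).1 - ⨅ θ, honestLoss ℓ D H θ
        ≤ runLyapunov L ℓ D H p adv T s :=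
    sub_iInf_le_lyapunov (hμ.le.trans hμL) ..
  have gap_measurable : Measurable fun s : A × (ℕ → Round n m d) =>
      honestLoss ℓ D H (state ℓ D H p adv s.1 s.2 T).1 - ⨅ θ, honestLoss ℓ D H θ :=
    ((differentiable_honestLoss hd).continuous.measurable.comp
      (measurable_state hp adv T).fst).sub_const _
  have gap_integrable := hint.mono' gap_measurable.aestronglyMeasurable <| .of_forall fun s => by
    simpa only [Real.norm_of_nonneg (hc.sub_iInf_nonneg hμ _)] using gap_le s
  exact ⟨gap_integrable, (integral_mono gap_integrable hint gap_le).trans hle⟩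

end Convergence

/-! ### Constants -/

section Constants

theorem two_mul_lt_of_ratio {n f : ℕ} {η : ℝ} (hη : 0 < η) (hn : 1 ≤ n)
    (h : (2 + η) * (f : ℝ) ≤ n) : 2 * f < n := by
  rcases f.eq_zero_or_pos with rfl | hf
  · exact hn
  · have : (0 : ℝ) < η * f := by positivity
    have : (2 : ℝ) * f < n := by linarith
    exact_mod_cast this

theorem trimCoeff_le_of_ratio {n f : ℕ} {η : ℝ} (hη : 0 < η) (hn : 1 ≤ n)
    (h : (2 + η) * (f : ℝ) ≤ n) : trimCoeff n f ≤ 6 * ((2 + η) / η) ^ 2 * (f / n) := by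
  have hf : (0 : ℝ) < n - 2 * f := sub_pos.2 (by exact_mod_cast two_mul_lt_of_ratio hη hn h)
  have : (0 : ℝ) < n := by exact_mod_cast hn
  have n_le : (n : ℝ) ≤ (2 + η) / η * (n - 2 * f) := by
    rw [div_mul_eq_mul_div, le_div_iff₀ hη]
    linarith
  rw [trimCoeff, div_le_iff₀ (by positivity)]
  calc 6 * (f : ℝ) * (n - f) ≤ 6 * f * n := by
        gcongr
        exact sub_le_self _ f.cast_nonneg
    _ = 6 * (f / n) * n ^ 2 := by field_simp
    _ ≤ 6 * (f / n) * ((2 + η) / η * (n - 2 * f)) ^ 2 := by gcongr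
    _ = 6 * ((2 + η) / η) ^ 2 * (f / n) * (n - 2 * f) ^ 2 := by ring

theorem inv_sub_le_two_div {n f : ℝ} (hn : 0 < n) (hf : 2 * f ≤ n) : (n - f)⁻¹ ≤ 2 / n := by
  rw [← inv_div]
  exact inv_anti₀ (by positivity) (by linarith)

theorem mul_div_sub_le {n f Q : ℝ} (hn : 0 < n) (hf : 2 * f ≤ n) (hQ : 0 ≤ Q) :
    n * (32 * Q / (n - f)) ≤ 64 * Q :=
  calc n * (32 * Q / (n - f)) = n * (32 * Q * (n - f)⁻¹) := by rw [div_eq_mul_inv]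
    _ ≤ n * (32 * Q * (2 / n)) := by gcongr; exact inv_sub_le_two_div hn hf
    _ = 64 * Q := by field_simp; ring

theorem add_one_div_sub_mul_div_sub_le {n f Q : ℝ} (hn : 1 ≤ n) (hf0 : 0 ≤ f) (hf : 2 * f ≤ n)
    (hQ : 0 ≤ Q) : (f + 1) / (n - f) * (32 * Q / (n - f)) ≤ 128 * (f / n * Q + Q / n ^ 2) := by
  have hn0 : 0 < n := zero_lt_one.trans_le hn
  have hnf : 0 < n - f := by linarith
  have hinv := inv_sub_le_two_div hn0 hf
  calc (f + 1) / (n - f) * (32 * Q / (n - f))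
      = (f + 1) * (n - f)⁻¹ * (32 * Q * (n - f)⁻¹) := by simp only [div_eq_mul_inv]
    _ ≤ (f + 1) * (2 / n) * (32 * Q * (2 / n)) := by gcongr
    _ = 128 * (f / n * (Q / n) + Q / n ^ 2) := by field_simp; ring
    _ ≤ 128 * (f / n * Q + Q / n ^ 2) := by gcongr; exact div_le_self hQ hn

theorem asymptotic_bound_lt {n f : ℕ} {η L μ Q B : ℝ} (hη : 0 < η) (hn : 1 ≤ n)
    (h : (2 + η) * (f : ℝ) ≤ n) (hL : 0 < L) (hμ : 0 < μ) (hQ : 0 < Q) (hB : 0 ≤ B) :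
    trimCoeff n f * B / μ + L / μ ^ 2 * (9600 * trimCoeff n f * (n * (32 * Q / (n - f)))
        + 115200 * (((f : ℝ) + 1) / (n - f) * (32 * Q / (n - f))))
      < (2 * 10 ^ 7 * ((2 + η) / η) ^ 2 + 2 * 10 ^ 7) *
        (L / μ ^ 2 * (f / n * Q + Q / n ^ 2) + 1 / μ * (f / n * B)) := by
  have hf2 := two_mul_lt_of_ratio hη hn h
  have hf : (2 : ℝ) * f ≤ n := by exact_mod_cast hf2.le
  have hn1 : (1 : ℝ) ≤ n := by exact_mod_cast hn
  have hn0 : (0 : ℝ) < n := zero_lt_one.trans_le hn1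
  have hnf : (0 : ℝ) < n - f := by linarith
  have hκ := trimCoeff_le_of_ratio hη hn h
  have := trimCoeff_nonneg (n := n) (f := f) (by lia)
  set w := ((2 + η) / η) ^ 2
  have bias : trimCoeff n f * B / μ ≤ 6 * w * (1 / μ * (f / n * B)) :=
    calc trimCoeff n f * B / μ ≤ 6 * w * (f / n) * B / μ := by gcongr
      _ = 6 * w * (1 / μ * (f / n * B)) := by ring
  have shared_noise : trimCoeff n f * (n * (32 * Q / (n - f))) ≤ 384 * w * (f / n * Q) :=
    calc trimCoeff n f * (n * (32 * Q / (n - f))) ≤ 6 * w * (f / n) * (64 * Q) :=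
          mul_le_mul hκ (mul_div_sub_le hn0 hf hQ.le) (by positivity) (by positivity)
      _ = 384 * w * (f / n * Q) := by ring
  have averaged_noise := add_one_div_sub_mul_div_sub_le hn1 f.cast_nonneg hf hQ.le
  calc _ ≤ 6 * w * (1 / μ * (f / n * B)) + L / μ ^ 2 * (9600 * (384 * w * (f / n * Q))
        + 115200 * (128 * (f / n * Q + Q / n ^ 2))) := by
        rw [mul_assoc 9600]
        gcongr
    _ < _ := by
        have : 0 < L / μ ^ 2 * (Q / n ^ 2) := by positivity
        have : 0 ≤ w * (L / μ ^ 2 * (Q / n ^ 2)) := by positivity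
        have : 0 ≤ L / μ ^ 2 * (f / n * Q) := by positivity
        have : 0 ≤ w * (L / μ ^ 2 * (f / n * Q)) := by positivity
        have : 0 ≤ 1 / μ * (f / n * B) := by positivity
        have : 0 ≤ w * (1 / μ * (f / n * B)) := by positivity
        linarith

end Constants

/-! ### Robustness -/

section Robustness

theorem noiseVar_nonneg {n f : ℕ} {δ : ℝ} (hf : f ≤ n) (hδ : 0 < δ) (hδ1 : δ ≤ 1) (T : ℕ)
    (C ε : ℝ) : 0 ≤ noiseVar n f T C ε δ := by
  have hnf : (0 : ℝ) ≤ n - f := sub_nonneg.2 (by exact_mod_cast hf)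
  have hlog : 0 ≤ Real.log (1 / δ) := Real.log_nonneg ((one_le_div hδ).2 hδ1)
  unfold noiseVar
  positivity

theorem noiseVar_mul_dim (n f T d : ℕ) (C ε δ : ℝ) :
    noiseVar n f T C ε δ * d
      = T * (32 * (C ^ 2 * d * Real.log (1 / δ) / ε ^ 2) / ((n : ℝ) - f)) := by
  rw [noiseVar, ← div_div]
  ring

theorem eventually_add_div_lt {a b c ϱ : ℝ} (h : b + c < ϱ) (r : ℝ) :
    ∀ᶠ T : ℕ in Filter.atTop, b + (r + c * T) / (T + a) < ϱ := by
  have limit := tendsto_add_mul_div_add_mul_atTop_nhds r a c one_ne_zero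
  simp only [one_mul, div_one, add_comm a] at limit
  exact (limit.const_add b).eventually_lt_const h

variable {X : Type*} {n m d f b : ℕ} {ℓ : E d → X → ℝ} {D : Fin n → Fin m → X}
  {H : Finset (Fin n)} {θ₀ : E d} {C ε δ L μ σ G : ℝ}

theorem IsRobust.mono {p : Params n d} {T : ℕ} {ϱ ϱ' : ℝ} (h : IsRobust ℓ D H p T ϱ)
    (hϱ : ϱ ≤ ϱ') : IsRobust ℓ D H p T ϱ' :=
  fun A _ ν _ adv => ⟨(h A ν adv).1, (h A ν adv).2.trans hϱ⟩

theorem isRobust_of_subsingleton [Subsingleton (E d)] {p : Params n d} {T : ℕ} {ϱ : ℝ}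
    (hϱ : 0 ≤ ϱ) : IsRobust ℓ D H p T ϱ := by
  intro A _ ν _ adv
  have gap_eq_zero (θ : E d) : honestLoss ℓ D H θ - ⨅ θ', honestLoss ℓ D H θ' = 0 := by
    have (θ' : E d) : honestLoss ℓ D H θ' = honestLoss ℓ D H θ := by rw [Subsingleton.elim θ' θ]
    simp only [this, ciInf_const, sub_self]
  simp only [gap_eq_zero]
  exact ⟨integrable_zero _ _ _, by simpa using hϱ⟩

theorem isRobust_cwtm (hf : 2 * f < n) (hHc : H.card = n - f) (hb : 1 ≤ b) (hbm : b ≤ m)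
    (hδ : 0 < δ) (hδ1 : δ ≤ 1) (hμ : 0 < μ) (hμL : μ ≤ L)
    (hd : ∀ i ∈ H, ∀ j, Differentiable ℝ fun θ => ℓ θ (D i j))
    (hG : BoundedHeterogeneity ℓ D H G) (hσ : BoundedVariance ℓ D H σ)
    (hs : IsSmooth L (honestLoss ℓ D H)) (hc : IsStronglyConvex μ (honestLoss ℓ D H)) (T : ℕ) :
    IsRobust ℓ D H (cwtmParams n d f b T C ε δ L μ θ₀) T (trimCoeff n f * (d * G ^ 2) / μ
      + (240 * (L / μ) * lyapunov L (honestLoss ℓ D H) θ₀ 0 + L / μ ^ 2 *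
          (4800 * trimCoeff n f * (2 * σ ^ 2 + 2 * (n * (noiseVar n f T C ε δ * d)))
            + 57600 * (2 * σ ^ 2
              + 2 * (((f : ℝ) + 1) / (n - f) * (noiseVar n f T C ε δ * d)))))
        / (T + 240 * (L / μ))) := by
  have hfn : f ≤ n := by lia
  have hs0 := noiseVar_nonneg hfn hδ hδ1 T C ε
  have hcard : (H.card : ℝ) = n - f := by rw [hHc, Nat.cast_sub hfn]
  exact isRobust_of_isRobustAveraging (p := cwtmParams n d f b T C ε δ L μ θ₀) hb hbm hd
    (measurable_cwtm f) (spread_gradient_le hd hG)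
    (fun θ i hi => (integral_norm_gradError_sq_le hb hbm hs0 hs0 hσ hi θ).trans_eq (by ring))
    (by positivity) hHc (trimCoeff_nonneg hfn) (isRobustAveraging_cwtm hf)
    (fun θ => (integral_norm_mean_gradError_sq_le hb hbm hs0 hs0 hσ θ).trans_eq (by
      rw [hcard]
      ring)) hs hc hμ hμL rfl (fun _ => rfl) T

theorem exists_isRobust_cwtm (hf : 2 * f < n) (hHc : H.card = n - f) (hb : 1 ≤ b) (hbm : b ≤ m)
    (hδ : 0 < δ) (hδ1 : δ ≤ 1) (hμ : 0 < μ) (hμL : μ ≤ L)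
    (hd : ∀ i ∈ H, ∀ j, Differentiable ℝ fun θ => ℓ θ (D i j))
    (hG : BoundedHeterogeneity ℓ D H G) (hσ : BoundedVariance ℓ D H σ)
    (hs : IsSmooth L (honestLoss ℓ D H)) (hc : IsStronglyConvex μ (honestLoss ℓ D H))
    {Q ϱ : ℝ} (hQ : Q = C ^ 2 * d * Real.log (1 / δ) / ε ^ 2)
    (hϱ : trimCoeff n f * (d * G ^ 2) / μ
      + L / μ ^ 2 * (9600 * trimCoeff n f * (n * (32 * Q / (n - f)))
        + 115200 * (((f : ℝ) + 1) / (n - f) * (32 * Q / (n - f)))) < ϱ) :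
    ∃ T₀ : ℕ, ∀ T ≥ T₀, IsRobust ℓ D H (cwtmParams n d f b T C ε δ L μ θ₀) T ϱ := by
  obtain ⟨T₀, hT₀⟩ := Filter.eventually_atTop.1 <| eventually_add_div_lt (a := 240 * (L / μ)) hϱ <|
    240 * (L / μ) * lyapunov L (honestLoss ℓ D H) θ₀ 0
      + L / μ ^ 2 * ((4800 * trimCoeff n f + 57600) * (2 * σ ^ 2))
  refine ⟨T₀, fun T hT =>
    (isRobust_cwtm hf hHc hb hbm hδ hδ1 hμ hμL hd hG hσ hs hc T).mono (le_trans ?_ (hT₀ T hT).le)⟩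
  rw [noiseVar_mul_dim, ← hQ]
  refine le_of_eq ?_
  ring

end Robustness

end CafCor

end

theorem mainTheorem5 (η : ℝ) (hη : 0 < η) :
    ∃ K : ℝ, 0 < K ∧
      ∀ {X : Type*} (n m d f b : ℕ) (ℓ : CafCor.E d → X → ℝ) (D : Fin n → Fin m → X)
        (H : Finset (Fin n)) (θ₀ : CafCor.E d) (C ε δ L μ σ G : ℝ),
        1 ≤ n → (2 + η) * (f : ℝ) ≤ n → H.card = n - f →
        1 ≤ b → b ≤ m →
        0 < C → 0 < ε → 0 < δ → δ < 1 → 0 < L → 0 < μ → 0 < σ → 0 < G →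
        (∀ i ∈ H, ∀ j, Differentiable ℝ fun θ => ℓ θ (D i j)) →
        CafCor.BoundedHeterogeneity ℓ D H G →
        CafCor.BoundedVariance ℓ D H σ →
        CafCor.IsSmooth L (CafCor.honestLoss ℓ D H) →
        CafCor.IsStronglyConvex μ (CafCor.honestLoss ℓ D H) →
        ∃ T₀ : ℕ, ∀ T ≥ T₀,
          CafCor.IsRobust ℓ D H (CafCor.cwtmParams n d f b T C ε δ L μ θ₀) T
            (K * (L / μ ^ 2 * ((f : ℝ) / n * (C ^ 2 * d * Real.log (1 / δ) / ε ^ 2)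
                  + C ^ 2 * d * Real.log (1 / δ) / ((n : ℝ) ^ 2 * ε ^ 2))
                + 1 / μ * ((f : ℝ) / n * d * G ^ 2))) := by
  refine ⟨2 * 10 ^ 7 * ((2 + η) / η) ^ 2 + 2 * 10 ^ 7, by positivity, ?_⟩
  intro X n m d f b ℓ D H θ₀ C ε δ L μ σ G hn hratio hHc hb hbm hC hε hδ hδ1 hL hμ _ _ hd hG hσ
    hs hc
  have hlog : 0 < Real.log (1 / δ) := Real.log_pos ((one_lt_div hδ).2 hδ1)
  rcases d.eq_zero_or_pos with rfl | hdim
  · exact ⟨0, fun T _ => CafCor.isRobust_of_subsingleton (by positivity)⟩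
  have : NeZero d := ⟨hdim.ne'⟩
  have hμL : μ ≤ L := hc.le_of_isSmooth hs
  have hf : 2 * f < n := CafCor.two_mul_lt_of_ratio hη hn hratio
  rw [mul_assoc ((f : ℝ) / n), mul_comm ((n : ℝ) ^ 2), ← div_div]
  exact CafCor.exists_isRobust_cwtm hf hHc hb hbm hδ hδ1.le hμ hμL hd hG hσ hs hc rfl
    (CafCor.asymptotic_bound_lt hη hn hratio hL hμ (by positivity) (by positivity))
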